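/- Let $N\ge 1$ and label the $N$-qubit Pauli operators up to phase by $\alpha=(\alpha^x,\alpha^z)\in\mathbb Z_2^{2N}$, writing $\sigma(\alpha)$ for the Hermitian Pauli operator with label $\alpha$. Let $W_1=\{X_i,Y_i,Z_i\}_{i=1}^N$ be the set of single-qubit Pauli operators (and of their labels). Let $H=-\sum_{k=1}^M J_k g_k$, $J_k\in\mathbb R$, where $g_1,\dots,g_M$ are pairwise commuting Hermitian Pauli operators, i.e. operators $\pm\sigma(\gamma_k)$. For $a\in\mathbb Z_2^M$ put $P(a)=\prod_k\frac12(1+(-1)^{a_k}g_k)$ and $\epsilon_a=-\sum_kJ_k(-1)^{a_k}$, and call $a$ a syndrome if $P(a)\neq 0$. For $\eta\in\mathbb Z_2^{2N}$ let $e_k(\eta)\in\{0,1\}$ equal $1$ exactly when $\sigma(\eta)$ anticommutes with $g_k$, put $\overline e_k(\eta)=1-e_k(\eta)$, and let $\omega^\alpha(a)=\epsilon_a-\epsilon_{a\oplus e(\alpha)}$. Let $\beta\ge 0$, and for $\alpha\in W_1$ let $h^\alpha:\mathbb R\to(0,\infty)$ satisfy the KMS condition $h^\alpha(-\omega)=h^\alpha(\omega)e^{-\beta\omega}$.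 The Davies generator is $$\mathcal L_\beta(f)=\sum_{\alpha\in W_1}\sum_{\omega}h^\alpha(\omega)\Big(S_\omega^{\alpha\dagger} f S_\omega^{\alpha}-\tfrac12\{S_\omega^{\alpha\dagger}S_\omega^{\alpha},f\}\Big),\qquad S^\alpha_\omega=\sum_{a:\ \omega^\alpha(a)=\omega}\sigma(\alpha)P(a),$$ where $\omega$ runs over the differences of eigenvalues of $H$. Let $\lambda$ be its spectral gap, the smallest value of $-\mathrm{Re}\,\mu$ over the nonzero eigenvalues $\mu$ of $\mathcal L_\beta$, let $\rho=e^{-\beta H}/\mathrm{tr}\,e^{-\beta H}$, and let $h^*=\min h^\alpha(\omega^\alpha(a))$, the minimum being over $\alpha\in W_1$ and all syndromes $a$. A Pauli path for $\eta\in\mathbb Z_2^{2N}$ is an ordering $\alpha_1,\dots,\alpha_T$ of a subset of $W_1$ with $\eta=\alpha_1\oplus\dots\oplus\alpha_T$ (so the $\alpha_i$ are pairwise distinct); its length is $T$, and with $\overline\eta_t=\alpha_1\oplus\dots\oplus\alpha_t$ its cost is $\max_{0\le t\le T}\sum_{k}2|J_k|\,e_k(\overline\eta_t)\,\overline e_k(\eta)$.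 Let $\overline\epsilon(\eta)$ be the minimum of the cost over all Pauli paths for $\eta$, and let $\overline\epsilon=\max_\eta\overline\epsilon(\eta)$ be the generalized energy barrier. Then there is a choice $\Gamma$ of one Pauli path for every $\eta\in\mathbb Z_2^{2N}$ such that the path for each $\eta$ has cost $\overline\epsilon(\eta)$. For every choice $\Gamma$ of one Pauli path for every $\eta$ in which all paths have cost at most $\overline\epsilon$ (in particular, for every cost-minimizing choice), the maximal length $\eta^*$ of the paths in $\Gamma$ satisfies $\eta^*\le 3N$, and $$\lambda\ \ge\ \frac{h^*}{4\eta^*}\,e^{-2\beta\overline\epsilon};$$ moreover the Poincaré inequality $c\,\big(\mathrm{tr}(\rho f^\dagger f)-|\mathrm{tr}(\rho f)|^2\big)\le-\mathrm{Re}\,\mathrm{tr}(\rho f^\dagger\mathcal L_\beta(f))$ holds for all $2^N\times2^N$ matrices $f$ with the constant $c=\frac{h^*}{4\eta^*}e^{-2\beta\overline\epsilon}$. Consequently $\lambda\ge\frac{h^*}{12N}\,e^{-2\beta\overline\epsilon}=\Omega(h^* N^{-1}e^{-2\beta\overline\epsilon})$. -/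

import Mathlib

open scoped Matrix

noncomputable section

namespace PauliDavies

/-- Computational basis labels of `N` qubits. -/
abbrev Qubits (N : ℕ) := Fin N → Fin 2

/-- The algebra of `2 ^ N × 2 ^ N` complex matrices. -/
abbrev Op (N : ℕ) := Matrix (Qubits N) (Qubits N) ℂ

/-- Pauli labels `α = (α^x, α^z)`, vectors of length `2N` over the field with two elements. -/
abbrev PauliLabel (N : ℕ) := (Fin N → ZMod 2) × (Fin N → ZMod 2)

/-- The one-qubit Pauli matrices: `(0,0) ↦ 1`, `(0,1) ↦ Z`, `(1,0) ↦ X`, `(1,1) ↦ Y`. -/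
def pauliOne (x z : ZMod 2) : Matrix (Fin 2) (Fin 2) ℂ :=
  if x = 0 then
    if z = 0 then 1 else !![1, 0; 0, -1]
  else
    if z = 0 then !![0, 1; 1, 0] else !![0, -Complex.I; Complex.I, 0]

/-- The Pauli operator `σ(α)`: the tensor product over the qubits of one-qubit Pauli matrices. -/
def pauli {N : ℕ} (α : PauliLabel N) : Op N :=
  Matrix.of fun j k => ∏ i, pauliOne (α.1 i) (α.2 i) (j i) (k i)

/-- The number of qubits on which `σ(α)` acts non-trivially. -/
def weight {N : ℕ} (α : PauliLabel N) : ℕ :=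
  (Finset.univ.filter fun i => α.1 i ≠ 0 ∨ α.2 i ≠ 0).card

/-- The single-qubit Pauli operators `{X_i, Y_i, Z_i}`. -/
def W1 (N : ℕ) : Finset (PauliLabel N) :=
  Finset.univ.filter fun α => weight α = 1

/-- The sign `(-1)^b` of a bit. -/
def bitSign (b : ZMod 2) : ℝ := (-1) ^ b.val

/-- The symplectic product modulo two. -/
def symp {N : ℕ} (γ η : PauliLabel N) : ZMod 2 :=
  ∑ i, (γ.1 i * η.2 i + γ.2 i * η.1 i)

/-- The data of a commuting Pauli Hamiltonian `H = - ∑ k, J k • g k` on `N` qubits. Every Hermitian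
element of the Pauli group is `± σ(γ)`; the generators are recorded by their labels and signs. -/
structure CommutingPauli (N M : ℕ) where
  label : Fin M → PauliLabel N
  sign : Fin M → ℤˣ
  J : Fin M → ℝ
  commute : ∀ i j, Commute (pauli (label i)) (pauli (label j))

namespace CommutingPauli

variable {N M : ℕ} (H : CommutingPauli N M)

/-- The Hermitian Pauli operator `g k`. -/
def gen (k : Fin M) : Op N := (((H.sign k : ℤˣ) : ℤ) : ℂ) • pauli (H.label k)

/-- The Hamiltonian. -/
def hamiltonian : Op N := -∑ k, ((H.J k : ℝ) : ℂ) • H.gen k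

/-- The projector `(1 + (-1)^b g k) / 2`. -/
def localProj (k : Fin M) (b : ZMod 2) : Op N :=
  (1 / 2 : ℂ) • (1 + ((bitSign b : ℝ) : ℂ) • H.gen k)

theorem gen_commute (i j : Fin M) : Commute (H.gen i) (H.gen j) :=
  ((H.commute i j).smul_left _).smul_right _

theorem localProj_commute (i j : Fin M) (b c : ZMod 2) :
    Commute (H.localProj i b) (H.localProj j c) := by
  refine Commute.smul_left (Commute.smul_right ?_ _) _
  refine Commute.add_left (Commute.one_left _) (Commute.add_right (Commute.one_right _) ?_)
  exact ((H.gen_commute i j).smul_left _).smul_right _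

/-- The joint eigenprojector `P(a)`, the product over `k` of the local projectors. -/
def proj (a : Fin M → ZMod 2) : Op N :=
  Finset.univ.noncommProd (fun k => H.localProj k (a k))
    fun i _ j _ _ => H.localProj_commute i j (a i) (a j)

open Classical in
/-- The legitimate syndromes: those `a` with `P(a) ≠ 0`. -/
def syndromes : Finset (Fin M → ZMod 2) :=
  Finset.univ.filter fun a => H.proj a ≠ 0

/-- The syndrome `e(η)` of a Pauli operator; `e k (η) = 1` when `σ(η)` anti-commutes with `g k`. -/
def syndrome (η : PauliLabel N) : Fin M → ZMod 2 := fun k => symp (H.label k) η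

/-- The energy `ε_a` of the syndrome `a`. -/
def energy (a : Fin M → ZMod 2) : ℝ := -∑ k, H.J k * bitSign (a k)

/-- The Bohr frequency `ω^α(a) = ε_a - ε_{a ⊕ e(α)}`. -/
def omega (α : PauliLabel N) (a : Fin M → ZMod 2) : ℝ :=
  H.energy a - H.energy (a + H.syndrome α)

/-- The Bohr frequencies: all differences of eigenvalues of the Hamiltonian. -/
def bohr : Finset ℝ :=
  (H.syndromes ×ˢ H.syndromes).image fun p => H.energy p.1 - H.energy p.2

open Classical in
/-- The Fourier component `S^α_ω` of the coupling operator `σ(α)`. -/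
def jump (α : PauliLabel N) (ω : ℝ) : Op N :=
  ∑ a, if H.omega α a = ω then pauli α * H.proj a else 0

/-- The Davies generator (in the Heisenberg picture) with single-qubit Pauli couplings and
transition rates `h`. -/
def davies (h : PauliLabel N → ℝ → ℝ) : Op N →ₗ[ℂ] Op N where
  toFun f := ∑ α ∈ W1 N, ∑ ω ∈ H.bohr, ((h α ω : ℝ) : ℂ) •
    ((H.jump α ω)ᴴ * f * H.jump α ω - (1 / 2 : ℂ) •
      ((H.jump α ω)ᴴ * H.jump α ω * f + f * ((H.jump α ω)ᴴ * H.jump α ω)))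
  map_add' f g := by
    simp only [← Finset.sum_add_distrib]
    refine Finset.sum_congr rfl fun α _ => Finset.sum_congr rfl fun ω _ => ?_
    rw [← smul_add]
    congr 1
    simp only [mul_add, add_mul, smul_add]
    abel
  map_smul' c f := by
    simp only [Finset.smul_sum, RingHom.id_apply]
    refine Finset.sum_congr rfl fun α _ => Finset.sum_congr rfl fun ω _ => ?_
    rw [smul_comm c]
    congr 1
    simp only [Matrix.mul_smul, Matrix.smul_mul, smul_sub, smul_add]
    rw [smul_comm c, smul_comm c]

/-- The Gibbs state `exp(-β H) / tr exp(-β H)`. -/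
def gibbs (β : ℝ) : Op N :=
  (Matrix.trace (NormedSpace.exp (-(β : ℂ) • H.hamiltonian)))⁻¹ •
    NormedSpace.exp (-(β : ℂ) • H.hamiltonian)

/-- The smallest transition rate `h^*`, over all couplings and all legitimate syndromes. -/
def minRate (h : PauliLabel N → ℝ → ℝ) : ℝ :=
  sInf {x | ∃ α ∈ W1 N, ∃ a ∈ H.syndromes, x = h α (H.omega α a)}

end CommutingPauli

/-- The variance `tr(ρ f† f) - |tr(ρ f)|²`. -/
def variance {N : ℕ} (ρ f : Op N) : ℝ :=
  (Matrix.trace (ρ * fᴴ * f)).re - ‖Matrix.trace (ρ * f)‖ ^ 2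

/-- The Dirichlet form `-tr(ρ f† L(f))`. -/
def dirichlet {N : ℕ} (ρ : Op N) (L : Op N →ₗ[ℂ] Op N) (f : Op N) : ℝ :=
  -(Matrix.trace (ρ * fᴴ * L f)).re

/-- The spectral gap: the smallest value of `-Re μ` over the nonzero eigenvalues `μ`. -/
def spectralGap {N : ℕ} (L : Op N →ₗ[ℂ] Op N) : ℝ :=
  sInf {x | ∃ μ : ℂ, Module.End.HasEigenvalue L μ ∧ μ ≠ 0 ∧ x = -μ.re}

/-- A Pauli path for `η`: an ordering of a subset `{α_1, …, α_T}` of the single-qubit Pauli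
operators with `η = α_1 ⊕ … ⊕ α_T`. -/
structure PauliPath {N : ℕ} (η : PauliLabel N) where
  steps : List (PauliLabel N)
  mem_W1 : ∀ α ∈ steps, α ∈ W1 N
  nodup : steps.Nodup
  sum_steps : steps.sum = η

namespace PauliPath

variable {N M : ℕ} {η : PauliLabel N}

/-- The length `T` of the path. -/
def length (p : PauliPath η) : ℕ := p.steps.length

/-- The partially constructed Pauli operator after `t` steps. -/
def partialSum (p : PauliPath η) (t : ℕ) : PauliLabel N := (p.steps.take t).sum

/-- The largest intermediate energy along the path, counting only the generators that `σ(η)` does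
not itself violate: the maximum over `0 ≤ t ≤ T` of `∑ k, 2 |J k| e k (η_t) (1 - e k (η))`. -/
def cost (H : CommutingPauli N M) (p : PauliPath η) : ℝ :=
  (Finset.range (p.length + 1)).sup' Finset.nonempty_range_add_one fun t =>
    ∑ k, 2 * |H.J k| * ((H.syndrome (p.partialSum t) k).val : ℝ) *
      ((H.syndrome η k + 1).val : ℝ)

end PauliPath

/-- The energy cost `ε̄(η)`: the minimum of the path cost over all Pauli paths for `η`. -/
def energyCost {N M : ℕ} (H : CommutingPauli N M) (η : PauliLabel N) : ℝ :=
  ⨅ p : PauliPath η, p.cost H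

/-- The generalized energy barrier `ε̄`: the maximum of the energy cost over all Paulis. -/
def genBarrier {N M : ℕ} (H : CommutingPauli N M) : ℝ :=
  Finset.univ.sup' Finset.univ_nonempty fun η : PauliLabel N => energyCost H η

/-- The length `η^*` of the longest path in a choice `Γ` of one Pauli path for every Pauli. -/
def maxLength {N : ℕ} (Γ : ∀ η : PauliLabel N, PauliPath η) : ℕ :=
  Finset.univ.sup fun η => (Γ η).length

end PauliDavies

end

/-!
The proof is a canonical-path argument for the Davies generator.

Write `w_b` for the eigenvalue of the Gibbs state `ρ` on the range of the syndrome projector `P(b)`,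
and `‖A‖²` for the squared Frobenius norm. All Pauli operators permute the projectors,
`σ(η) P(b) σ(η) = P(b ⊕ e(η))` (`conj_proj`), and the average over all Pauli conjugations is the
completely depolarizing map (`sum_conj`). The latter turns the variance into an average of squared
differences (`variance_eq`):
`2 · 2^N Var(f) = ∑_η ∑_b w_b w_{b ⊕ e(η)} ‖(f - σ(η) f σ(η)) P(b)‖²`.

Along a Pauli path for `η` the difference `f - σ(η) f σ(η)` telescopes into conjugates by the
partial products `ξ` of the single-qubit differences `f - σ(α) f σ(α)`. Moving the conjugation onto
the projectors shifts `b` by `e(ξ)`, and the weights satisfy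
`w_{b ⊕ e(ξ)} w_{b ⊕ e(ξ) ⊕ e(η)} ≤ exp(2 β C) w_b w_{b ⊕ e(η)}` where `C` is the cost of the path: a
generator that `σ(η)` violates contributes zero to both total energies (`energy_add_le`). After
Cauchy-Schwarz, and since `∑_η w_{b ⊕ e(η)} = 2^N` for every legitimate syndrome, this gives
`2 Var(f) ≤ η^* exp(2 β C) ∑_α ∑_b w_b ‖(f - σ(α) f σ(α)) P(b)‖²` (`variance_le`).

In the other direction, the blocks `P(a) f P(b)` make the generator explicit
(`proj_mul_davies_mul_proj`). Detailed balance, `w_b h(ω(b))` being invariant under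
`b ↦ b ⊕ e(α)`, shows that the Dirichlet form is at least
`(1/8) ∑_α ∑_b w_b h^α(ω^α(b)) ‖(f - σ(α) f σ(α)) P(b)‖²` (`dirichlet_ge`). Together they give the
Poincaré inequality `minRate_mul_variance_le`.

Finally, a Poincaré inequality for a faithful state bounds the gap (`le_spectralGap`): nonnegativity
of the Dirichlet form makes `ρ` stationary, so eigenvectors with nonzero eigenvalue have vanishing
expectation, and the Poincaré inequality applied to them bounds the real part of the eigenvalue.
-/

noncomputable section

namespace PauliDavies

/-! ### Pauli operators -/

theorem zmod_two_cases (x : ZMod 2) : x = 0 ∨ x = 1 := by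
  revert x; decide

theorem zmod_two_one_add_one : (1 + 1 : ZMod 2) = 0 := by decide

theorem bitSign_zero : bitSign 0 = 1 := by simp [bitSign]

theorem bitSign_one : bitSign 1 = -1 := by simp [bitSign, ZMod.val_one]

theorem bitSign_add (a b : ZMod 2) : bitSign (a + b) = bitSign a * bitSign b := by
  rcases zmod_two_cases a with rfl | rfl <;> rcases zmod_two_cases b with rfl | rfl <;>
    simp [bitSign_zero, bitSign_one, zmod_two_one_add_one]

theorem bitSign_sum {ι : Type*} (s : Finset ι) (f : ι → ZMod 2) :
    bitSign (∑ i ∈ s, f i) = ∏ i ∈ s, bitSign (f i) := by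
  induction s using Finset.cons_induction with
  | empty => simp [bitSign_zero]
  | cons i s hi ih => rw [Finset.sum_cons, Finset.prod_cons, bitSign_add, ih]

theorem bitSign_mul_self (a : ZMod 2) : bitSign a * bitSign a = 1 := by
  rcases zmod_two_cases a with rfl | rfl <;> simp [bitSign_zero, bitSign_one]

theorem pauliOne_zero_zero : pauliOne 0 0 = !![1, 0; 0, 1] := by
  simp [pauliOne, Matrix.one_fin_two]

theorem pauliOne_zero_one : pauliOne 0 1 = !![1, 0; 0, -1] := by simp [pauliOne]

theorem pauliOne_one_zero : pauliOne 1 0 = !![0, 1; 1, 0] := by simp [pauliOne]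

theorem pauliOne_one_one : pauliOne 1 1 = !![0, -Complex.I; Complex.I, 0] := by simp [pauliOne]

theorem pauliOne_conjTranspose (x z : ZMod 2) : (pauliOne x z)ᴴ = pauliOne x z := by
  rcases zmod_two_cases x with rfl | rfl <;> rcases zmod_two_cases z with rfl | rfl <;>
    simp only [pauliOne_zero_zero, pauliOne_zero_one, pauliOne_one_zero, pauliOne_one_one] <;>
    ext i j <;> fin_cases i <;> fin_cases j <;> simp

theorem pauliOne_mul_self (x z : ZMod 2) : pauliOne x z * pauliOne x z = 1 := by
  rcases zmod_two_cases x with rfl | rfl <;> rcases zmod_two_cases z with rfl | rfl <;>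
    simp [pauliOne_zero_zero, pauliOne_zero_one, pauliOne_one_zero, pauliOne_one_one,
      Matrix.one_fin_two]

theorem pauliOne_comm (x z x' z' : ZMod 2) :
    pauliOne x z * pauliOne x' z' =
      ((bitSign (x * z' + z * x') : ℝ) : ℂ) • (pauliOne x' z' * pauliOne x z) := by
  rcases zmod_two_cases x with rfl | rfl <;> rcases zmod_two_cases z with rfl | rfl <;>
  rcases zmod_two_cases x' with rfl | rfl <;> rcases zmod_two_cases z' with rfl | rfl <;>
    simp [pauliOne_zero_zero, pauliOne_zero_one, pauliOne_one_zero, pauliOne_one_one,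
      zmod_two_one_add_one, bitSign_zero, bitSign_one]

theorem pauliOne_mul (x z x' z' : ZMod 2) :
    ∃ c : ℂ, ‖c‖ = 1 ∧ pauliOne (x + x') (z + z') = c • (pauliOne x z * pauliOne x' z') := by
  suffices h : pauliOne (x + x') (z + z') = (1 : ℂ) • (pauliOne x z * pauliOne x' z') ∨
      pauliOne (x + x') (z + z') = Complex.I • (pauliOne x z * pauliOne x' z') ∨
      pauliOne (x + x') (z + z') = (-Complex.I) • (pauliOne x z * pauliOne x' z') by
    rcases h with h | h | h
    · exact ⟨_, by simp, h⟩
    · exact ⟨_, by simp, h⟩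
    · exact ⟨_, by simp, h⟩
  rcases zmod_two_cases x with rfl | rfl <;> rcases zmod_two_cases z with rfl | rfl <;>
  rcases zmod_two_cases x' with rfl | rfl <;> rcases zmod_two_cases z' with rfl | rfl <;>
    simp [pauliOne_zero_zero, pauliOne_zero_one, pauliOne_one_zero, pauliOne_one_one,
      zmod_two_one_add_one]

/-- Completeness of the one-qubit Pauli matrices. -/
theorem sum_pauliOne (i j k l : Fin 2) :
    ∑ p : ZMod 2 × ZMod 2, pauliOne p.1 p.2 i j * pauliOne p.1 p.2 k l =
      if i = l ∧ j = k then 2 else 0 := by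
  rw [Fintype.sum_prod_type]
  have : ∀ f : ZMod 2 → ℂ, ∑ x, f x = f 0 + f 1 := fun f => Fin.sum_univ_two f
  simp only [this, pauliOne_zero_zero, pauliOne_zero_one, pauliOne_one_zero, pauliOne_one_one]
  fin_cases i <;> fin_cases j <;> fin_cases k <;> fin_cases l <;>
    simp <;> norm_num

section

variable {N : ℕ}

/-- Tensor products of one-qubit matrices, written out entrywise, multiply factor by factor. -/
theorem tensor_mul (A B : Fin N → Matrix (Fin 2) (Fin 2) ℂ) :
    (Matrix.of fun j k : Qubits N => ∏ i, A i (j i) (k i)) *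
      (Matrix.of fun j k : Qubits N => ∏ i, B i (j i) (k i)) =
      Matrix.of fun j k : Qubits N => ∏ i, (A i * B i) (j i) (k i) := by
  ext j k
  simp only [Matrix.mul_apply, Matrix.of_apply, ← Finset.prod_mul_distrib]
  rw [Finset.prod_univ_sum]
  simp [Fintype.piFinset_univ]

theorem tensor_smul (c : Fin N → ℂ) (A : Fin N → Matrix (Fin 2) (Fin 2) ℂ) :
    (Matrix.of fun j k : Qubits N => ∏ i, (c i • A i) (j i) (k i)) =
      (∏ i, c i) • Matrix.of fun j k : Qubits N => ∏ i, A i (j i) (k i) := by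
  ext j k
  simp [Finset.prod_mul_distrib]

theorem tensor_one :
    (Matrix.of fun j k : Qubits N => ∏ i, (1 : Matrix (Fin 2) (Fin 2) ℂ) (j i) (k i)) = 1 := by
  ext j k
  rw [Matrix.of_apply, Matrix.one_apply]
  split_ifs with h
  · subst h; simp
  · obtain ⟨i, hi⟩ := Function.ne_iff.1 h
    exact Finset.prod_eq_zero (Finset.mem_univ i) (by simp [hi])

theorem pauli_conjTranspose (α : PauliLabel N) : (pauli α)ᴴ = pauli α := by
  ext j k
  simp only [pauli, Matrix.conjTranspose_apply, Matrix.of_apply, star_prod]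
  exact Finset.prod_congr rfl fun i _ =>
    congrFun (congrFun (pauliOne_conjTranspose (α.1 i) (α.2 i)) (j i)) (k i)

theorem pauli_mul_self (α : PauliLabel N) : pauli α * pauli α = 1 := by
  simp only [pauli, tensor_mul, pauliOne_mul_self, tensor_one]

theorem pauli_comm (α γ : PauliLabel N) :
    pauli α * pauli γ = ((bitSign (symp α γ) : ℝ) : ℂ) • (pauli γ * pauli α) := by
  simp only [pauli, tensor_mul, symp, bitSign_sum, Complex.ofReal_prod, ← tensor_smul]
  simp only [← pauliOne_comm]

theorem pauli_add (α γ : PauliLabel N) :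
    ∃ c : ℂ, ‖c‖ = 1 ∧ pauli (α + γ) = c • (pauli α * pauli γ) := by
  choose c hc h using fun i => pauliOne_mul (α.1 i) (α.2 i) (γ.1 i) (γ.2 i)
  refine ⟨∏ i, c i, by simp [hc], ?_⟩
  simp only [pauli, tensor_mul, ← tensor_smul, ← h]
  rfl

theorem symp_comm (α γ : PauliLabel N) : symp α γ = symp γ α :=
  Finset.sum_congr rfl fun i _ => by ring

/-- Conjugation of an operator by the Pauli operator `σ(α)`. -/
def conj (α : PauliLabel N) (f : Op N) : Op N := pauli α * f * pauli α

theorem pauli_mul_cancel (α : PauliLabel N) (f : Op N) : pauli α * (pauli α * f) = f := by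
  rw [← mul_assoc, pauli_mul_self, one_mul]

theorem conj_mul (α : PauliLabel N) (f g : Op N) : conj α (f * g) = conj α f * conj α g := by
  simp only [conj, mul_assoc, pauli_mul_cancel]

theorem conj_sub (α : PauliLabel N) (f g : Op N) : conj α (f - g) = conj α f - conj α g := by
  simp only [conj, mul_sub, sub_mul]

theorem conj_conj (α : PauliLabel N) (f : Op N) : conj α (conj α f) = f := by
  simp only [conj, mul_assoc, pauli_mul_cancel, pauli_mul_self, mul_one]

theorem conj_conjTranspose (α : PauliLabel N) (f : Op N) : (conj α f)ᴴ = conj α fᴴ := by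
  simp only [conj, Matrix.conjTranspose_mul, pauli_conjTranspose, mul_assoc]

theorem trace_conj (α : PauliLabel N) (f : Op N) : (conj α f).trace = f.trace := by
  rw [conj, Matrix.trace_mul_comm, pauli_mul_cancel]

/-- Conjugation is a homomorphism: the phases relating `σ(α + γ)` to `σ(α) σ(γ)` cancel. -/
theorem conj_add (α γ : PauliLabel N) (f : Op N) : conj (α + γ) f = conj α (conj γ f) := by
  obtain ⟨c, hc, h⟩ := pauli_add α γ
  have h' : pauli (α + γ) = star c • (pauli γ * pauli α) := by
    rw [← pauli_conjTranspose, h, Matrix.conjTranspose_smul, Matrix.conjTranspose_mul,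
      pauli_conjTranspose, pauli_conjTranspose]
  have hcc : c * star c = 1 := by
    rw [Complex.star_def, Complex.mul_conj, Complex.normSq_eq_norm_sq, hc]; simp
  calc conj (α + γ) f = (c • (pauli α * pauli γ)) * f * (star c • (pauli γ * pauli α)) := by
        rw [← h, ← h', conj]
    _ = conj α (conj γ f) := by
        simp only [Matrix.smul_mul, Matrix.mul_smul, smul_smul, conj, mul_assoc]
        rw [mul_comm, hcc, one_smul]

theorem conj_zero (f : Op N) : conj 0 f = f := by
  have h : pauli (0 : PauliLabel N) = 1 := by
    rw [← tensor_one]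
    simp only [pauli, Prod.fst_zero, Prod.snd_zero, Pi.zero_apply, pauliOne_zero_zero,
      Matrix.one_fin_two]
  rw [conj, h, one_mul, mul_one]

/-- Completeness of the Pauli operators: averaging over all conjugations is the completely
depolarizing map. -/
theorem sum_conj (f : Op N) : ∑ η, conj η f = ((2 : ℂ) ^ N * f.trace) • (1 : Op N) := by
  have key : ∀ j l m k : Qubits N, ∑ η : PauliLabel N, pauli η j l * pauli η m k =
      if j = k ∧ l = m then 2 ^ N else 0 := by
    intro j l m k
    have h1 : ∑ η : PauliLabel N, pauli η j l * pauli η m k =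
        ∑ q : Fin N → ZMod 2 × ZMod 2, ∏ i, (pauliOne (q i).1 (q i).2 (j i) (l i) *
          pauliOne (q i).1 (q i).2 (m i) (k i)) := by
      refine (Fintype.sum_equiv (Equiv.arrowProdEquivProdArrow (Fin N) _ _) _ _ ?_).symm
      intro q
      simp [pauli, Finset.prod_mul_distrib, Equiv.arrowProdEquivProdArrow]
    rw [h1, ← Fintype.piFinset_univ, ← Finset.prod_univ_sum (fun _ => Finset.univ)
      (fun i (p : ZMod 2 × ZMod 2) => pauliOne p.1 p.2 (j i) (l i) * pauliOne p.1 p.2 (m i) (k i))]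
    simp only [sum_pauliOne]
    split_ifs with h
    · obtain ⟨rfl, rfl⟩ := h
      simp
    · have : ∃ i, ¬ (j i = k i ∧ l i = m i) := by
        by_contra! h'
        exact h ⟨funext fun i => (h' i).1, funext fun i => (h' i).2⟩
      obtain ⟨i, hi⟩ := this
      exact Finset.prod_eq_zero (Finset.mem_univ i) (if_neg hi)
  ext j k
  rw [Matrix.sum_apply]
  simp only [conj, Matrix.mul_apply, Finset.sum_mul]
  have h2 : ∀ η : PauliLabel N, ∀ m l, pauli η j l * f l m * pauli η m k =
      f l m * (pauli η j l * pauli η m k) := fun η m l => by ring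
  simp only [h2]
  rw [Finset.sum_comm]
  simp only [Finset.sum_comm (s := (Finset.univ : Finset (PauliLabel N))), ← Finset.mul_sum, key]
  by_cases hjk : j = k
  · simp [hjk, Matrix.trace, Finset.mul_sum, mul_comm]
  · simp [hjk]

end

/-! ### Syndrome projectors and the Gibbs state -/

theorem conj_smul {N : ℕ} (α : PauliLabel N) (c : ℂ) (f : Op N) :
    conj α (c • f) = c • conj α f := by
  simp only [conj, Matrix.mul_smul, Matrix.smul_mul]

theorem conj_one {N : ℕ} (α : PauliLabel N) : conj α (1 : Op N) = 1 := by
  rw [conj, mul_one, pauli_mul_self]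

theorem conj_pauli {N : ℕ} (η α : PauliLabel N) :
    conj η (pauli α) = ((bitSign (symp α η) : ℝ) : ℂ) • pauli α := by
  rw [conj, pauli_comm, symp_comm, Matrix.smul_mul, mul_assoc, pauli_mul_self, mul_one]

/-- Adding a Pauli label twice to a syndrome does nothing. -/
theorem add_add_self {M : ℕ} (a e : Fin M → ZMod 2) : a + e + e = a := by
  funext k
  have : ∀ x y : ZMod 2, x + y + y = x := by decide
  exact this (a k) (e k)

namespace CommutingPauli

variable {N M : ℕ} (H : CommutingPauli N M)

theorem gen_mul_self (k : Fin M) : H.gen k * H.gen k = 1 := by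
  rw [gen, Matrix.smul_mul, Matrix.mul_smul, smul_smul, pauli_mul_self]
  rcases Int.units_eq_one_or (H.sign k) with h | h <;> simp [h]

theorem gen_conjTranspose (k : Fin M) : (H.gen k)ᴴ = H.gen k := by
  rw [gen, Matrix.conjTranspose_smul, pauli_conjTranspose]
  simp

theorem conj_gen (η : PauliLabel N) (k : Fin M) :
    conj η (H.gen k) = ((bitSign (H.syndrome η k) : ℝ) : ℂ) • H.gen k := by
  rw [gen, conj_smul, conj_pauli, smul_comm, syndrome]

theorem conj_localProj (η : PauliLabel N) (k : Fin M) (b : ZMod 2) :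
    conj η (H.localProj k b) = H.localProj k (b + H.syndrome η k) := by
  have h : ∀ f g : Op N, conj η (f + g) = conj η f + conj η g := fun f g => by
    simp only [conj, mul_add, add_mul]
  rw [localProj, localProj, conj_smul, h, conj_one, conj_smul, conj_gen, smul_smul, bitSign_add,
    Complex.ofReal_mul]

theorem localProj_pairwise (s : Finset (Fin M)) (a : Fin M → ZMod 2) :
    (s : Set (Fin M)).Pairwise (Function.onFun Commute fun k => H.localProj k (a k)) :=
  fun i _ j _ _ => H.localProj_commute i j (a i) (a j)

theorem proj_eq (a : Fin M → ZMod 2) : H.proj a =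
    Finset.univ.noncommProd (fun k => H.localProj k (a k)) (H.localProj_pairwise _ a) := rfl

theorem conj_proj (η : PauliLabel N) (a : Fin M → ZMod 2) :
    conj η (H.proj a) = H.proj (a + H.syndrome η) := by
  let F : Op N →* Op N := ⟨⟨conj η, conj_one η⟩, conj_mul η⟩
  change F (H.proj a) = _
  rw [proj_eq, Finset.map_noncommProd, proj_eq]
  exact Finset.noncommProd_congr rfl (fun k _ => H.conj_localProj η k (a k)) _

theorem gen_mul_localProj (k : Fin M) (b : ZMod 2) :
    H.gen k * H.localProj k b = ((bitSign b : ℝ) : ℂ) • H.localProj k b := by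
  have h : ((bitSign b : ℝ) : ℂ) * ((bitSign b : ℝ) : ℂ) = 1 := by
    rw [← Complex.ofReal_mul, bitSign_mul_self, Complex.ofReal_one]
  rw [localProj, Matrix.mul_smul, mul_add, mul_one, Matrix.mul_smul, gen_mul_self, smul_comm]
  congr 1
  rw [smul_add, smul_smul, h, one_smul, add_comm]

theorem gen_mul_proj (k : Fin M) (a : Fin M → ZMod 2) :
    H.gen k * H.proj a = ((bitSign (a k) : ℝ) : ℂ) • H.proj a := by
  rw [proj_eq, ← Finset.mul_noncommProd_erase _ (Finset.mem_univ k), ← mul_assoc, gen_mul_localProj,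
    Matrix.smul_mul]

theorem gen_commute_proj (k : Fin M) (a : Fin M → ZMod 2) : Commute (H.gen k) (H.proj a) := by
  refine Finset.noncommProd_commute _ _ _ _ fun j _ => ?_
  exact Commute.smul_right
    (Commute.add_right (Commute.one_right _) ((H.gen_commute k j).smul_right _)) _

theorem proj_mul_gen (k : Fin M) (a : Fin M → ZMod 2) :
    H.proj a * H.gen k = ((bitSign (a k) : ℝ) : ℂ) • H.proj a := by
  rw [← (H.gen_commute_proj k a).eq, gen_mul_proj]

/-- An operator on which each generator acts on the right by its sign is fixed by `P(a)`. -/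
theorem mul_proj_eq_self {X : Op N} {a : Fin M → ZMod 2}
    (hX : ∀ k, X * H.gen k = ((bitSign (a k) : ℝ) : ℂ) • X) : X * H.proj a = X := by
  refine Finset.noncommProd_induction _ _ _ (fun Y => X * Y = X)
    (fun Y Z hY hZ => by rw [← mul_assoc, hY, hZ]) (mul_one X) fun k _ => ?_
  have h : ((bitSign (a k) : ℝ) : ℂ) * ((bitSign (a k) : ℝ) : ℂ) = 1 := by
    rw [← Complex.ofReal_mul, bitSign_mul_self, Complex.ofReal_one]
  rw [localProj, Matrix.mul_smul, mul_add, mul_one, Matrix.mul_smul, hX, smul_smul, h, one_smul,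
    ← two_smul ℂ, smul_smul]
  norm_num

theorem proj_mul_self (a : Fin M → ZMod 2) : H.proj a * H.proj a = H.proj a :=
  H.mul_proj_eq_self fun k => H.proj_mul_gen k a

theorem proj_conjTranspose (a : Fin M → ZMod 2) : (H.proj a)ᴴ = H.proj a := by
  have h : (H.proj a)ᴴ * H.proj a = (H.proj a)ᴴ := H.mul_proj_eq_self fun k => by
    have := congrArg Matrix.conjTranspose (H.gen_mul_proj k a)
    rw [Matrix.conjTranspose_mul, gen_conjTranspose, Matrix.conjTranspose_smul] at this
    simpa using this
  have h' := congrArg Matrix.conjTranspose h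
  rw [Matrix.conjTranspose_mul, Matrix.conjTranspose_conjTranspose] at h'
  rw [← h, h']

theorem proj_mul_proj_of_ne {a b : Fin M → ZMod 2} (hab : a ≠ b) : H.proj a * H.proj b = 0 := by
  obtain ⟨k, hk⟩ := Function.ne_iff.1 hab
  have h : ((bitSign (a k) : ℝ) : ℂ) • (H.proj a * H.proj b) =
      ((bitSign (b k) : ℝ) : ℂ) • (H.proj a * H.proj b) := by
    rw [← Matrix.smul_mul, ← proj_mul_gen, mul_assoc, gen_mul_proj, Matrix.mul_smul]
  have hne : ((bitSign (a k) : ℝ) : ℂ) - ((bitSign (b k) : ℝ) : ℂ) ≠ 0 := by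
    rcases zmod_two_cases (a k) with ha | ha <;> rcases zmod_two_cases (b k) with hb | hb <;>
      rw [ha, hb] at hk ⊢ <;> first | exact absurd rfl hk | (norm_num [bitSign_zero, bitSign_one])
  rw [← sub_eq_zero, ← sub_smul] at h
  exact (smul_eq_zero.1 h).resolve_left hne

theorem proj_mul_proj (a b : Fin M → ZMod 2) :
    H.proj a * H.proj b = if a = b then H.proj b else 0 := by
  split_ifs with h
  · rw [h, proj_mul_self]
  · exact H.proj_mul_proj_of_ne h

/-- Completeness of the projectors in a form suited to induction on the set of generators. -/
theorem eq_zero_of_forall_noncommProd_mul (s : Finset (Fin M)) :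
    ∀ X : Op N, (∀ a : Fin M → ZMod 2, s.noncommProd (fun k => H.localProj k (a k))
      (H.localProj_pairwise s a) * X = 0) → X = 0 := by
  induction s using Finset.cons_induction with
  | empty => intro X hX; simpa only [Finset.noncommProd_empty, one_mul] using hX 0
  | cons k s hk ih =>
    intro X hX
    have h : ∀ b, H.localProj k b * X = 0 := by
      refine fun b => ih _ fun a => ?_
      have := hX (Function.update a k b)
      rw [Finset.noncommProd_cons', Function.update_self, mul_assoc] at this
      rw [← this]
      congr 1
      refine Finset.noncommProd_congr rfl (fun i hi => ?_) _
      rw [Function.update_of_ne (ne_of_mem_of_not_mem hi hk)]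
    have h1 : H.localProj k 0 + H.localProj k 1 = 1 := by
      rw [localProj, localProj, bitSign_zero, bitSign_one, ← smul_add]
      have : (1 + ((1 : ℝ) : ℂ) • H.gen k + (1 + ((-1 : ℝ) : ℂ) • H.gen k)) = (2 : ℂ) • 1 := by
        push_cast
        rw [neg_smul, two_smul]; abel
      rw [this, smul_smul]; norm_num
    rw [← one_mul X, ← h1, add_mul, h, h, add_zero]

theorem sum_proj : ∑ a, H.proj a = 1 := by
  refine (sub_eq_zero.1 (H.eq_zero_of_forall_noncommProd_mul Finset.univ _ fun a => ?_)).symm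
  change H.proj a * _ = 0
  rw [mul_sub, mul_one, Finset.mul_sum]
  simp [proj_mul_proj]

theorem hamiltonian_eq : H.hamiltonian = ∑ a, ((H.energy a : ℝ) : ℂ) • H.proj a := by
  rw [← mul_one H.hamiltonian, ← H.sum_proj, Finset.mul_sum]
  refine Finset.sum_congr rfl fun a _ => ?_
  rw [hamiltonian, neg_mul, Finset.sum_mul, energy]
  simp only [Matrix.smul_mul, gen_mul_proj, smul_smul, Complex.ofReal_neg, Complex.ofReal_sum,
    Complex.ofReal_mul, neg_smul, Finset.sum_smul]

/-- Functional calculus: scalar functions of the syndrome as operators. -/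
def diagHom : ((Fin M → ZMod 2) → ℂ) →ₐ[ℂ] Op N :=
  AlgHom.ofLinearMap
    { toFun := fun v => ∑ a, v a • H.proj a
      map_add' := fun v w => by simp only [Pi.add_apply, add_smul, Finset.sum_add_distrib]
      map_smul' := fun c v => by
        simp only [Pi.smul_apply, smul_eq_mul, mul_smul, Finset.smul_sum, RingHom.id_apply] }
    (by simp [sum_proj])
    (fun v w => by
      simp only [LinearMap.coe_mk, AddHom.coe_mk, Finset.sum_mul, Finset.mul_sum, Matrix.smul_mul,
        Matrix.mul_smul, proj_mul_proj, smul_ite, smul_zero, Pi.mul_apply, smul_smul]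
      simp [mul_comm])

theorem diagHom_apply (v : (Fin M → ZMod 2) → ℂ) : H.diagHom v = ∑ a, v a • H.proj a := rfl

theorem exp_hamiltonian (β : ℝ) : NormedSpace.exp (-(β : ℂ) • H.hamiltonian) =
    ∑ a, ((Real.exp (-β * H.energy a) : ℝ) : ℂ) • H.proj a := by
  have h : -(β : ℂ) • H.hamiltonian = H.diagHom fun a => ((-β * H.energy a : ℝ) : ℂ) := by
    rw [hamiltonian_eq, diagHom_apply, Finset.smul_sum]
    simp only [smul_smul, Complex.ofReal_mul, Complex.ofReal_neg]
  -- any norm inducing the matrix topology serves here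
  let _ : NormedRing (Op N) := Matrix.linftyOpNormedRing
  let _ : NormedAlgebra ℂ (Op N) := Matrix.linftyOpNormedAlgebra
  let _ : NormedAlgebra ℚ (Op N) := NormedAlgebra.restrictScalars ℚ ℂ _
  have hc : Continuous H.diagHom := LinearMap.continuous_of_finiteDimensional H.diagHom.toLinearMap
  rw [h]
  refine (NormedSpace.map_exp H.diagHom hc _).symm.trans ?_
  rw [diagHom_apply]
  refine Finset.sum_congr rfl fun a _ => ?_
  rw [Pi.coe_exp, ← Complex.exp_eq_exp_ℂ, Complex.ofReal_exp]

end CommutingPauli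

variable {N M : ℕ}

/-! ### The squared Frobenius norm -/

/-- The squared Frobenius norm `tr(A† A)`. -/
def frobSq (A : Op N) : ℝ := (Aᴴ * A).trace.re

theorem frobSq_eq_sum (A : Op N) : frobSq A = ∑ j, ∑ i, ‖A i j‖ ^ 2 := by
  simp only [frobSq, Matrix.trace, Matrix.diag, Matrix.mul_apply, Matrix.conjTranspose_apply,
    Complex.re_sum]
  refine Finset.sum_congr rfl fun j _ => Finset.sum_congr rfl fun i _ => ?_
  rw [Complex.star_def, ← Complex.normSq_eq_conj_mul_self, Complex.ofReal_re,
    Complex.normSq_eq_norm_sq]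

theorem frobSq_nonneg (A : Op N) : 0 ≤ frobSq A := by
  rw [frobSq_eq_sum]; positivity

theorem trace_conjTranspose_mul_self (A : Op N) : (Aᴴ * A).trace = (frobSq A : ℂ) := by
  refine Complex.ext rfl ?_
  have h : star (Aᴴ * A).trace = (Aᴴ * A).trace := by
    rw [← Matrix.trace_conjTranspose, Matrix.conjTranspose_mul, Matrix.conjTranspose_conjTranspose]
  rw [Complex.ofReal_im]
  exact Complex.conj_eq_iff_im.1 h

open scoped ComplexOrder in
theorem frobSq_pos {A : Op N} (hA : A ≠ 0) : 0 < frobSq A := by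
  refine lt_of_le_of_ne (frobSq_nonneg A) fun h => hA ?_
  have h0 : (Aᴴ * A).trace = 0 := by rw [trace_conjTranspose_mul_self, ← h, Complex.ofReal_zero]
  exact Matrix.trace_conjTranspose_mul_self_eq_zero_iff.1 h0

theorem frobSq_zero : frobSq (0 : Op N) = 0 := by simp [frobSq]

theorem re_trace_conjTranspose_mul_comm (A B : Op N) :
    (Bᴴ * A).trace.re = (Aᴴ * B).trace.re := by
  rw [← Complex.conj_re, ← Complex.star_def, ← Matrix.trace_conjTranspose,
    Matrix.conjTranspose_mul, Matrix.conjTranspose_conjTranspose]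

theorem frobSq_sub (A B : Op N) :
    frobSq (A - B) = frobSq A + frobSq B - 2 * (Aᴴ * B).trace.re := by
  simp only [frobSq, Matrix.conjTranspose_sub, sub_mul, mul_sub, Matrix.trace_sub, Complex.sub_re]
  rw [re_trace_conjTranspose_mul_comm A B]; ring

theorem frobSq_sub_le (A B : Op N) : frobSq (A - B) ≤ 2 * frobSq A + 2 * frobSq B := by
  simp only [frobSq_eq_sum, Finset.mul_sum, ← Finset.sum_add_distrib]
  refine Finset.sum_le_sum fun j _ => Finset.sum_le_sum fun i _ => ?_
  have h := norm_sub_le (A i j) (B i j)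
  rw [Matrix.sub_apply]
  nlinarith [sq_nonneg (‖A i j‖ - ‖B i j‖), norm_nonneg (A i j - B i j)]

theorem frobSq_sum_le {ι : Type*} (s : Finset ι) (A : ι → Op N) :
    frobSq (∑ t ∈ s, A t) ≤ s.card * ∑ t ∈ s, frobSq (A t) := by
  have h : (s.card : ℝ) * ∑ t ∈ s, frobSq (A t) =
      ∑ j, ∑ i, (s.card : ℝ) * ∑ t ∈ s, ‖A t i j‖ ^ 2 := by
    simp only [frobSq_eq_sum, ← Finset.mul_sum]
    rw [Finset.sum_comm]
    simp only [Finset.sum_comm (s := s)]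
  rw [h, frobSq_eq_sum]
  refine Finset.sum_le_sum fun j _ => Finset.sum_le_sum fun i _ => ?_
  rw [Matrix.sum_apply]
  calc ‖∑ t ∈ s, A t i j‖ ^ 2 ≤ (∑ t ∈ s, ‖A t i j‖) ^ 2 :=
        pow_le_pow_left₀ (norm_nonneg _) (norm_sum_le s fun t => A t i j) 2
    _ ≤ s.card * ∑ t ∈ s, ‖A t i j‖ ^ 2 := sq_sum_le_card_mul_sum_sq

theorem frobSq_conj (α : PauliLabel N) (A : Op N) : frobSq (conj α A) = frobSq A := by
  rw [frobSq, conj_conjTranspose, ← conj_mul, trace_conj, frobSq]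

namespace CommutingPauli

variable (H : CommutingPauli N M)

/-! ### The spectral decomposition of the Gibbs state -/

theorem trace_proj (a : Fin M → ZMod 2) : (H.proj a).trace = (frobSq (H.proj a) : ℂ) := by
  rw [← trace_conjTranspose_mul_self, proj_conjTranspose, proj_mul_self]

/-- At least one syndrome is legitimate, so the partition function is positive. -/
theorem exists_proj_ne_zero : ∃ a, H.proj a ≠ 0 := by
  by_contra! h
  have := H.sum_proj
  simp [h] at this

/-- The partition function `tr exp(-β H)`. -/
def partition (β : ℝ) : ℝ := ∑ a, Real.exp (-β * H.energy a) * frobSq (H.proj a)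

theorem partition_pos (β : ℝ) : 0 < H.partition β := by
  obtain ⟨a, ha⟩ := H.exists_proj_ne_zero
  exact Finset.sum_pos' (fun a _ => mul_nonneg (Real.exp_pos _).le (frobSq_nonneg _))
    ⟨a, Finset.mem_univ a, mul_pos (Real.exp_pos _) (frobSq_pos ha)⟩

/-- The Boltzmann weight of a syndrome: the eigenvalue of the Gibbs state on the range of `P(a)`. -/
def gibbsWeight (β : ℝ) (a : Fin M → ZMod 2) : ℝ := Real.exp (-β * H.energy a) / H.partition β

theorem gibbsWeight_pos (β : ℝ) (a : Fin M → ZMod 2) : 0 < H.gibbsWeight β a :=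
  div_pos (Real.exp_pos _) (H.partition_pos β)

theorem gibbs_eq (β : ℝ) : H.gibbs β = ∑ a, (H.gibbsWeight β a : ℂ) • H.proj a := by
  have h : (∑ a, ((Real.exp (-β * H.energy a) : ℝ) : ℂ) • H.proj a).trace =
      (H.partition β : ℂ) := by
    simp only [Matrix.trace_sum, Matrix.trace_smul, trace_proj, partition, Complex.ofReal_sum,
      Complex.ofReal_mul, smul_eq_mul]
  rw [gibbs, exp_hamiltonian, h, Finset.smul_sum]
  simp only [smul_smul, gibbsWeight, div_eq_inv_mul, Complex.ofReal_mul, Complex.ofReal_inv]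

theorem trace_gibbs (β : ℝ) : (H.gibbs β).trace = 1 := by
  have h : (H.gibbs β).trace = ((∑ a, H.gibbsWeight β a * frobSq (H.proj a) : ℝ) : ℂ) := by
    rw [gibbs_eq]
    simp only [Matrix.trace_sum, Matrix.trace_smul, trace_proj, Complex.ofReal_sum,
      Complex.ofReal_mul, smul_eq_mul]
  have h1 : ∑ a, H.gibbsWeight β a * frobSq (H.proj a) = 1 := by
    simp only [gibbsWeight, div_mul_eq_mul_div, ← Finset.sum_div]
    exact div_self (H.partition_pos β).ne'
  rw [h, h1, Complex.ofReal_one]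

theorem gibbs_conjTranspose (β : ℝ) : (H.gibbs β)ᴴ = H.gibbs β := by
  simp [gibbs_eq, Matrix.conjTranspose_sum, proj_conjTranspose]

theorem gibbs_mul_proj (β : ℝ) (b : Fin M → ZMod 2) :
    H.gibbs β * H.proj b = (H.gibbsWeight β b : ℂ) • H.proj b := by
  rw [gibbs_eq, Finset.sum_mul]
  simp [proj_mul_proj]

theorem conj_mul_proj (η : PauliLabel N) (f : Op N) (b : Fin M → ZMod 2) :
    conj η f * H.proj b = conj η (f * H.proj (b + H.syndrome η)) := by
  rw [conj_mul, conj_proj, add_add_self]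

theorem conj_gibbs_mul_proj (β : ℝ) (η : PauliLabel N) (b : Fin M → ZMod 2) :
    conj η (H.gibbs β) * H.proj b = (H.gibbsWeight β (b + H.syndrome η) : ℂ) • H.proj b := by
  rw [conj_mul_proj, gibbs_mul_proj, conj_smul, conj_proj, add_add_self]

theorem trace_gibbs_mul (β : ℝ) (f g : Op N) : (H.gibbs β * fᴴ * g).trace =
    ∑ b, (H.gibbsWeight β b : ℂ) * ((f * H.proj b)ᴴ * (g * H.proj b)).trace := by
  rw [gibbs_eq, Finset.sum_mul, Finset.sum_mul, Matrix.trace_sum]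
  refine Finset.sum_congr rfl fun b _ => ?_
  rw [Matrix.conjTranspose_mul, proj_conjTranspose, Matrix.smul_mul, Matrix.smul_mul,
    Matrix.trace_smul, smul_eq_mul, ← mul_assoc, Matrix.trace_mul_comm _ (H.proj b),
    ← mul_assoc, ← mul_assoc, proj_mul_self]

theorem trace_eq_sum_blocks (f g : Op N) : (fᴴ * g).trace =
    ∑ a, ((H.proj a * f)ᴴ * (H.proj a * g)).trace := by
  rw [← Matrix.trace_sum]
  congr 1
  simp only [Matrix.conjTranspose_mul, proj_conjTranspose, mul_assoc, ← Finset.mul_sum]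
  simp only [← mul_assoc (H.proj _) (H.proj _) g, proj_mul_self, ← Finset.sum_mul, sum_proj,
    one_mul]

theorem frobSq_eq_sum_blocks (f : Op N) : frobSq f = ∑ a, frobSq (H.proj a * f) := by
  rw [frobSq, H.trace_eq_sum_blocks, Complex.re_sum]
  rfl

/-- Depolarizing the Gibbs state gives the identity, read off on the range of `P(b)`. A syndrome with
`P(b) = 0` has to be excluded, since nothing constrains the weights there. -/
theorem sum_gibbsWeight (β : ℝ) {b : Fin M → ZMod 2} (hb : H.proj b ≠ 0) :
    ∑ η, H.gibbsWeight β (b + H.syndrome η) = 2 ^ N := by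
  have h := congrArg (· * H.proj b) (sum_conj (H.gibbs β))
  simp only [Finset.sum_mul, conj_gibbs_mul_proj, trace_gibbs, mul_one, ← Finset.sum_smul,
    Matrix.smul_mul, one_mul] at h
  rw [← sub_eq_zero, ← sub_smul] at h
  have := sub_eq_zero.1 ((smul_eq_zero.1 h).resolve_right hb)
  exact_mod_cast this

/-! ### The variance and Pauli paths -/

theorem sum_sum_gibbsWeight (β : ℝ) (F : (Fin M → ZMod 2) → ℝ)
    (hF : ∀ b, H.proj b = 0 → F b = 0) :
    ∑ η, ∑ b, H.gibbsWeight β b * H.gibbsWeight β (b + H.syndrome η) * F b =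
      2 ^ N * ∑ b, H.gibbsWeight β b * F b := by
  rw [Finset.sum_comm, Finset.mul_sum]
  refine Finset.sum_congr rfl fun b _ => ?_
  by_cases hb : H.proj b = 0
  · simp [hF b hb]
  · simp only [mul_assoc, ← Finset.mul_sum]
    rw [← Finset.sum_mul, H.sum_gibbsWeight β hb]
    ring

theorem sum_add_syndrome {R : Type*} [AddCommMonoid R] (e : Fin M → ZMod 2)
    (F : (Fin M → ZMod 2) → R) : ∑ b, F (b + e) = ∑ b, F b :=
  Fintype.sum_equiv (Equiv.addRight e) _ _ fun _ => rfl

/-- The variance as an average of the squared differences `f - σ(η) f σ(η)` over all Pauli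
operators. The cross terms are evaluated by the depolarizing identity `sum_conj`. -/
theorem variance_eq (β : ℝ) (f : Op N) :
    ∑ η, ∑ b, H.gibbsWeight β b * H.gibbsWeight β (b + H.syndrome η) *
      frobSq ((f - conj η f) * H.proj b) = 2 * 2 ^ N * variance (H.gibbs β) f := by
  set w := H.gibbsWeight β with hw
  have hd : (H.gibbs β * fᴴ * f).trace.re = ∑ b, w b * frobSq (f * H.proj b) := by
    rw [trace_gibbs_mul, Complex.re_sum]
    exact Finset.sum_congr rfl fun b _ => by rw [Complex.re_ofReal_mul, frobSq]
  have h1 : ∑ η, ∑ b, w b * w (b + H.syndrome η) * frobSq (f * H.proj b) =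
      2 ^ N * (H.gibbs β * fᴴ * f).trace.re := by
    rw [hd]
    exact H.sum_sum_gibbsWeight β _ fun b hb => by rw [hb, mul_zero, frobSq_zero]
  have h2 : ∑ η, ∑ b, w b * w (b + H.syndrome η) * frobSq (conj η f * H.proj b) =
      2 ^ N * (H.gibbs β * fᴴ * f).trace.re := by
    rw [← h1]
    refine Finset.sum_congr rfl fun η _ => ?_
    rw [← sum_add_syndrome (H.syndrome η)]
    refine Finset.sum_congr rfl fun b _ => ?_
    rw [conj_mul_proj, frobSq_conj, add_add_self]
    ring
  have h3 : ∑ η, ∑ b, ((w b * w (b + H.syndrome η) : ℝ) : ℂ) *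
      ((f * H.proj b)ᴴ * (conj η f * H.proj b)).trace =
        ((2 ^ N * ‖(H.gibbs β * f).trace‖ ^ 2 : ℝ) : ℂ) := by
    have h4 : ∀ η, ∑ b, ((w b * w (b + H.syndrome η) : ℝ) : ℂ) *
        ((f * H.proj b)ᴴ * (conj η f * H.proj b)).trace =
          (H.gibbs β * fᴴ * conj η (f * H.gibbs β)).trace := by
      intro η
      rw [trace_gibbs_mul]
      refine Finset.sum_congr rfl fun b _ => ?_
      rw [conj_mul, mul_assoc (conj η f), conj_gibbs_mul_proj, Matrix.mul_smul, Matrix.mul_smul,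
        Matrix.trace_smul, smul_eq_mul, Complex.ofReal_mul, mul_assoc]
    simp only [h4]
    rw [← Matrix.trace_sum, ← Finset.mul_sum, sum_conj, Matrix.mul_smul, mul_one,
      Matrix.trace_smul, smul_eq_mul, Matrix.trace_mul_comm f]
    have h5 : (H.gibbs β * fᴴ).trace = star (H.gibbs β * f).trace := by
      rw [← Matrix.trace_conjTranspose, Matrix.conjTranspose_mul, gibbs_conjTranspose,
        Matrix.trace_mul_comm]
    rw [h5, mul_assoc, Complex.star_def, Complex.mul_conj, Complex.normSq_eq_norm_sq]
    push_cast
    ring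
  have h6 : ∑ η, ∑ b, w b * w (b + H.syndrome η) *
      ((f * H.proj b)ᴴ * (conj η f * H.proj b)).trace.re =
        2 ^ N * ‖(H.gibbs β * f).trace‖ ^ 2 := by
    have := congrArg Complex.re h3
    rw [Complex.ofReal_re] at this
    simpa only [Complex.re_sum, Complex.re_ofReal_mul] using this
  simp only [sub_mul, frobSq_sub, mul_sub, mul_add, Finset.sum_add_distrib, Finset.sum_sub_distrib]
  rw [h1, h2]
  simp only [mul_left_comm _ (2 : ℝ), ← Finset.mul_sum]
  rw [h6, variance]
  ring

/-- Shifting the pair of syndromes `b`, `b ⊕ e` by `x` lowers the total energy by at most twice the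
energy of the generators violated by `x` outside `e`: a generator in `e` contributes zero to both
totals. -/
theorem energy_add_le (b x e : Fin M → ZMod 2) :
    H.energy b + H.energy (b + e) ≤ H.energy (b + x) + H.energy (b + x + e) +
      2 * ∑ k, 2 * |H.J k| * ((x k).val : ℝ) * ((e k + 1).val : ℝ) := by
  simp only [energy, Finset.mul_sum, ← Finset.sum_neg_distrib, ← Finset.sum_add_distrib]
  refine Finset.sum_le_sum fun k _ => ?_
  have h1 := le_abs_self (H.J k)
  have h2 := neg_abs_le (H.J k)
  simp only [Pi.add_apply, bitSign_add]
  rcases zmod_two_cases (b k) with hb | hb <;> rcases zmod_two_cases (x k) with hx | hx <;>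
    rcases zmod_two_cases (e k) with he | he <;>
    simp only [hb, hx, he, bitSign_zero, bitSign_one, zmod_two_one_add_one, zero_add,
      ZMod.val_zero, ZMod.val_one, Nat.cast_zero, Nat.cast_one] <;> linarith

theorem gibbsWeight_mul_le {β : ℝ} (hβ : 0 ≤ β) {C : ℝ} (b x e : Fin M → ZMod 2)
    (hC : ∑ k, 2 * |H.J k| * ((x k).val : ℝ) * ((e k + 1).val : ℝ) ≤ C) :
    H.gibbsWeight β (b + x) * H.gibbsWeight β (b + x + e) ≤
      Real.exp (2 * β * C) * (H.gibbsWeight β b * H.gibbsWeight β (b + e)) := by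
  have h := mul_le_mul_of_nonneg_left ((H.energy_add_le b x e).trans
    (add_le_add_right (mul_le_mul_of_nonneg_left hC zero_le_two) _)) hβ
  rw [gibbsWeight, gibbsWeight, gibbsWeight, gibbsWeight, div_mul_div_comm, div_mul_div_comm,
    ← Real.exp_add, ← Real.exp_add, mul_div_assoc', ← Real.exp_add]
  refine div_le_div_of_nonneg_right (Real.exp_le_exp.2 ?_) (mul_self_nonneg _)
  linarith

/-- Conjugation by a partial product `ξ` of a path is absorbed into a shift of the syndromes, which
costs the Boltzmann factor of the path. -/
theorem sum_frobSq_conj_le {β : ℝ} (hβ : 0 ≤ β) {C : ℝ} (ξ η : PauliLabel N) (X : Op N)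
    (hC : ∑ k, 2 * |H.J k| * ((H.syndrome ξ k).val : ℝ) *
      ((H.syndrome η k + 1).val : ℝ) ≤ C) :
    ∑ b, H.gibbsWeight β b * H.gibbsWeight β (b + H.syndrome η) *
        frobSq (conj ξ X * H.proj b) ≤
      Real.exp (2 * β * C) * ∑ b, H.gibbsWeight β b * H.gibbsWeight β (b + H.syndrome η) *
        frobSq (X * H.proj b) := by
  rw [← sum_add_syndrome (H.syndrome ξ), Finset.mul_sum]
  refine Finset.sum_le_sum fun b _ => ?_
  rw [conj_mul_proj, frobSq_conj, add_add_self, ← mul_assoc]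
  exact mul_le_mul_of_nonneg_right (H.gibbsWeight_mul_le hβ b _ _ hC) (frobSq_nonneg _)

end CommutingPauli

theorem PauliPath.sum_le_cost (H : CommutingPauli N M) {η : PauliLabel N} (p : PauliPath η)
    {t : ℕ} (ht : t ≤ p.length) :
    ∑ k, 2 * |H.J k| * ((H.syndrome (p.partialSum t) k).val : ℝ) *
      ((H.syndrome η k + 1).val : ℝ) ≤ p.cost H :=
  Finset.le_sup' (fun t => ∑ k, 2 * |H.J k| * ((H.syndrome (p.partialSum t) k).val : ℝ) *
      ((H.syndrome η k + 1).val : ℝ)) (Finset.mem_range_succ_iff.2 ht)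

/-- The difference `f - σ(η) f σ(η)` telescopes along a Pauli path for `η`. By Cauchy-Schwarz it is
controlled by the single-qubit differences, at the price of the length of the path and of the
Boltzmann factor of its cost. -/
theorem CommutingPauli.sum_frobSq_le_of_path (H : CommutingPauli N M) {β : ℝ} (hβ : 0 ≤ β) {C : ℝ}
    {η : PauliLabel N} (p : PauliPath η) (hp : p.cost H ≤ C) (f : Op N) :
    ∑ b, H.gibbsWeight β b * H.gibbsWeight β (b + H.syndrome η) *
        frobSq ((f - conj η f) * H.proj b) ≤
      p.length * Real.exp (2 * β * C) * ∑ α ∈ W1 N,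
        ∑ b, H.gibbsWeight β b * H.gibbsWeight β (b + H.syndrome η) *
          frobSq ((f - conj α f) * H.proj b) := by
  set w : (Fin M → ZMod 2) → ℝ := fun b => H.gibbsWeight β b * H.gibbsWeight β (b + H.syndrome η)
    with hw
  have hw0 : ∀ b, 0 ≤ w b := fun b =>
    (mul_pos (H.gibbsWeight_pos β _) (H.gibbsWeight_pos β _)).le
  let F : PauliLabel N → ℝ := fun α => ∑ b, w b * frobSq ((f - conj α f) * H.proj b)
  have hF0 : ∀ α, 0 ≤ F α := fun α =>
    Finset.sum_nonneg fun b _ => mul_nonneg (hw0 b) (frobSq_nonneg _)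
  let g : ℕ → Op N := fun t => conj (p.partialSum t) f - conj (p.partialSum (t + 1)) f
  have htel : f - conj η f = ∑ t ∈ Finset.range p.length, g t := by
    rw [Finset.sum_range_sub' (fun t => conj (p.partialSum t) f)]
    simp [PauliPath.partialSum, PauliPath.length, p.sum_steps, conj_zero]
  have hstep : ∀ t : Fin p.steps.length, ∑ b, w b * frobSq (g t * H.proj b) ≤
      Real.exp (2 * β * C) * F (p.steps[t]) := by
    intro t
    have hg : g t = conj (p.partialSum t) (f - conj (p.steps[t]) f) := by
      simp only [g, PauliPath.partialSum, Fin.getElem_fin]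
      rw [List.sum_take_succ _ _ t.2, conj_sub, ← conj_add]
    rw [hg]
    exact H.sum_frobSq_conj_le hβ _ η _ ((p.sum_le_cost H t.2.le).trans hp)
  have hsum : ∑ t : Fin p.steps.length, F (p.steps[t]) ≤ ∑ α ∈ W1 N, F α := by
    have h1 : ∑ t : Fin p.steps.length, F (p.steps[t]) = ∑ α ∈ p.steps.toFinset, F α := by
      rw [List.sum_toFinset _ p.nodup, ← Fin.sum_univ_fun_getElem]
      rfl
    rw [h1]
    exact Finset.sum_le_sum_of_subset_of_nonneg
      (fun α hα => p.mem_W1 α (List.mem_toFinset.1 hα)) fun α _ _ => hF0 α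
  calc ∑ b, w b * frobSq ((f - conj η f) * H.proj b)
      ≤ ∑ b, w b * (p.length * ∑ t ∈ Finset.range p.length, frobSq (g t * H.proj b)) := by
        refine Finset.sum_le_sum fun b _ => mul_le_mul_of_nonneg_left ?_ (hw0 b)
        rw [htel, Finset.sum_mul]
        exact (frobSq_sum_le _ _).trans_eq (by rw [Finset.card_range])
    _ = p.length * ∑ t : Fin p.steps.length, ∑ b, w b * frobSq (g t * H.proj b) := by
        simp only [mul_left_comm (w _)]
        rw [← Finset.mul_sum, Finset.sum_comm]
        simp only [← Finset.mul_sum, Finset.sum_range]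
        rfl
    _ ≤ p.length * ∑ t : Fin p.steps.length, Real.exp (2 * β * C) * F (p.steps[t]) := by
        gcongr with t
        exact hstep t
    _ ≤ p.length * (Real.exp (2 * β * C) * ∑ α ∈ W1 N, F α) := by
        rw [← Finset.mul_sum]
        gcongr
    _ = _ := (mul_assoc _ _ _).symm

/-- The variance is bounded by single-qubit differences weighted by the Gibbs state. -/
theorem CommutingPauli.variance_le (H : CommutingPauli N M) {β : ℝ} (hβ : 0 ≤ β) {C : ℝ}
    (Γ : ∀ η : PauliLabel N, PauliPath η) (hΓ : ∀ η, (Γ η).cost H ≤ C) (f : Op N) :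
    2 * variance (H.gibbs β) f ≤ maxLength Γ * Real.exp (2 * β * C) *
      ∑ α ∈ W1 N, ∑ b, H.gibbsWeight β b * frobSq ((f - conj α f) * H.proj b) := by
  have hw0 : ∀ η b, 0 ≤ H.gibbsWeight β b * H.gibbsWeight β (b + H.syndrome η) := fun η b =>
    (mul_pos (H.gibbsWeight_pos β _) (H.gibbsWeight_pos β _)).le
  have h : 2 ^ N * (2 * variance (H.gibbs β) f) ≤ 2 ^ N * (maxLength Γ * Real.exp (2 * β * C) *
      ∑ α ∈ W1 N, ∑ b, H.gibbsWeight β b * frobSq ((f - conj α f) * H.proj b)) := by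
    calc 2 ^ N * (2 * variance (H.gibbs β) f) = 2 * 2 ^ N * variance (H.gibbs β) f := by ring
      _ ≤ ∑ η, maxLength Γ * Real.exp (2 * β * C) * ∑ α ∈ W1 N,
          ∑ b, H.gibbsWeight β b * H.gibbsWeight β (b + H.syndrome η) *
            frobSq ((f - conj α f) * H.proj b) := by
        rw [← H.variance_eq]
        refine Finset.sum_le_sum fun η _ => (H.sum_frobSq_le_of_path hβ (Γ η) (hΓ η) f).trans ?_
        have hlen : ((Γ η).length : ℝ) ≤ maxLength Γ := by
          exact_mod_cast Finset.le_sup (f := fun η => (Γ η).length) (Finset.mem_univ η)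
        have : 0 ≤ ∑ α ∈ W1 N, ∑ b, H.gibbsWeight β b * H.gibbsWeight β (b + H.syndrome η) *
            frobSq ((f - conj α f) * H.proj b) :=
          Finset.sum_nonneg fun α _ => Finset.sum_nonneg fun b _ =>
            mul_nonneg (hw0 η b) (frobSq_nonneg _)
        gcongr
      _ = _ := by
        rw [← Finset.mul_sum, Finset.sum_comm, mul_left_comm (2 ^ N)]
        congr 1
        rw [Finset.mul_sum]
        refine Finset.sum_congr rfl fun α _ => ?_
        exact H.sum_sum_gibbsWeight β _ fun b hb => by rw [hb, mul_zero, frobSq_zero]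
  exact le_of_mul_le_mul_left h (by positivity)

/-! ### The Dirichlet form -/

namespace CommutingPauli

variable (H : CommutingPauli N M)

theorem omega_add_syndrome (α : PauliLabel N) (a : Fin M → ZMod 2) :
    H.omega α (a + H.syndrome α) = -H.omega α a := by
  rw [omega, omega, add_add_self]; ring

/-- The sum over Bohr frequencies in the generator sees every legitimate syndrome. -/
theorem omega_mem_bohr (α : PauliLabel N) {b : Fin M → ZMod 2} (hb : H.proj b ≠ 0) :
    H.omega α b ∈ H.bohr := by
  refine Finset.mem_image.2 ⟨(b, b + H.syndrome α), ?_, rfl⟩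
  simp only [syndromes, Finset.mem_product, Finset.mem_filter, Finset.mem_univ, true_and]
  refine ⟨hb, fun h => hb ?_⟩
  rw [← add_add_self b (H.syndrome α), ← conj_proj, h, conj, mul_zero, zero_mul]

theorem jump_mul_proj (α : PauliLabel N) (ω : ℝ) (b : Fin M → ZMod 2) :
    H.jump α ω * H.proj b = if H.omega α b = ω then pauli α * H.proj b else 0 := by
  rw [jump, Finset.sum_mul, Finset.sum_eq_single b]
  · split_ifs
    · rw [mul_assoc, proj_mul_self]
    · rw [zero_mul]
  · intro a _ hab
    split_ifs
    · rw [mul_assoc, H.proj_mul_proj_of_ne hab, mul_zero]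
    · rw [zero_mul]
  · simp

theorem proj_mul_jump_conjTranspose (α : PauliLabel N) (ω : ℝ) (a : Fin M → ZMod 2) :
    H.proj a * (H.jump α ω)ᴴ = if H.omega α a = ω then H.proj a * pauli α else 0 := by
  rw [← H.proj_conjTranspose a, ← Matrix.conjTranspose_mul, jump_mul_proj, proj_conjTranspose]
  split_ifs
  · rw [Matrix.conjTranspose_mul, proj_conjTranspose, pauli_conjTranspose]
  · rw [Matrix.conjTranspose_zero]

theorem jump_conjTranspose_mul_jump_mul_proj (α : PauliLabel N) (ω : ℝ) (b : Fin M → ZMod 2) :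
    (H.jump α ω)ᴴ * H.jump α ω * H.proj b = if H.omega α b = ω then H.proj b else 0 := by
  rw [mul_assoc, jump_mul_proj]
  split_ifs with h
  · rw [← one_mul ((H.jump α ω)ᴴ * _), ← H.sum_proj, Finset.sum_mul, Finset.sum_eq_single b]
    · rw [← mul_assoc, proj_mul_jump_conjTranspose, if_pos h, mul_assoc, pauli_mul_cancel,
        proj_mul_self]
    · intro a _ hab
      rw [← mul_assoc, proj_mul_jump_conjTranspose]
      split_ifs
      · rw [mul_assoc, pauli_mul_cancel, H.proj_mul_proj_of_ne hab]
      · rw [zero_mul]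
    · simp
  · rw [mul_zero]

theorem proj_mul_jump_conjTranspose_mul_jump (α : PauliLabel N) (ω : ℝ) (a : Fin M → ZMod 2) :
    H.proj a * ((H.jump α ω)ᴴ * H.jump α ω) = if H.omega α a = ω then H.proj a else 0 := by
  have h := congrArg Matrix.conjTranspose (H.jump_conjTranspose_mul_jump_mul_proj α ω a)
  rw [Matrix.conjTranspose_mul, Matrix.conjTranspose_mul, Matrix.conjTranspose_conjTranspose,
    proj_conjTranspose] at h
  rw [h]
  split_ifs
  · exact H.proj_conjTranspose a
  · exact Matrix.conjTranspose_zero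

/-- The blocks of the Davies generator: it couples the block `(a, b)` of `f` to the block
`(a ⊕ e(α), b ⊕ e(α))` when both syndromes have the same Bohr frequency, and damps it always. -/
theorem proj_mul_davies_mul_proj (h : PauliLabel N → ℝ → ℝ) (f : Op N) (a b : Fin M → ZMod 2) :
    H.proj a * H.davies h f * H.proj b = ∑ α ∈ W1 N,
      (((if H.omega α a = H.omega α b then h α (H.omega α b) else 0 : ℝ) : ℂ) •
        (H.proj a * conj α f * H.proj b) -
      (((h α (H.omega α a) + h α (H.omega α b)) / 2 : ℝ) : ℂ) • (H.proj a * f * H.proj b)) := by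
  by_cases ha : H.proj a = 0
  · simp [ha]
  by_cases hb : H.proj b = 0
  · simp [hb]
  change H.proj a * (∑ α ∈ W1 N, ∑ ω ∈ H.bohr, _) * _ = _
  rw [Finset.mul_sum, Finset.sum_mul]
  refine Finset.sum_congr rfl fun α _ => ?_
  rw [Finset.mul_sum, Finset.sum_mul]
  have hterm : ∀ ω, H.proj a * (((h α ω : ℝ) : ℂ) •
      ((H.jump α ω)ᴴ * f * H.jump α ω - (1 / 2 : ℂ) •
        ((H.jump α ω)ᴴ * H.jump α ω * f + f * ((H.jump α ω)ᴴ * H.jump α ω)))) * H.proj b =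
      (if H.omega α b = ω then ((if H.omega α a = ω then h α ω else 0 : ℝ) : ℂ) •
        (H.proj a * conj α f * H.proj b) else 0) -
      ((if H.omega α a = ω then ((h α ω / 2 : ℝ) : ℂ) • (H.proj a * f * H.proj b) else 0) +
      (if H.omega α b = ω then ((h α ω / 2 : ℝ) : ℂ) • (H.proj a * f * H.proj b) else 0)) := by
    intro ω
    have h1 : H.proj a * ((H.jump α ω)ᴴ * f * H.jump α ω) * H.proj b =
        if H.omega α b = ω then (if H.omega α a = ω then H.proj a * conj α f * H.proj b else 0)
          else 0 := by
      have : H.proj a * ((H.jump α ω)ᴴ * f * H.jump α ω) * H.proj b =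
          (H.proj a * (H.jump α ω)ᴴ) * f * (H.jump α ω * H.proj b) := by
        simp only [mul_assoc]
      rw [this, jump_mul_proj, proj_mul_jump_conjTranspose]
      split_ifs
      · simp only [conj, mul_assoc]
      all_goals simp only [zero_mul, mul_zero]
    have h2 : H.proj a * ((H.jump α ω)ᴴ * H.jump α ω * f) * H.proj b =
        if H.omega α a = ω then H.proj a * f * H.proj b else 0 := by
      rw [← mul_assoc, proj_mul_jump_conjTranspose_mul_jump]
      split_ifs <;> simp
    have h3 : H.proj a * (f * ((H.jump α ω)ᴴ * H.jump α ω)) * H.proj b =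
        if H.omega α b = ω then H.proj a * f * H.proj b else 0 := by
      rw [mul_assoc, mul_assoc f, jump_conjTranspose_mul_jump_mul_proj]
      split_ifs <;> simp [mul_assoc]
    rw [Matrix.mul_smul, Matrix.smul_mul, mul_sub, sub_mul, Matrix.mul_smul, Matrix.smul_mul,
      mul_add, add_mul, h1, h2, h3, smul_sub, smul_smul, smul_add]
    have hc : ((h α ω : ℝ) : ℂ) * (1 / 2) = ((h α ω / 2 : ℝ) : ℂ) := by push_cast; ring
    rw [hc]
    congr 1
    · split_ifs <;> simp
    · simp only [smul_ite, smul_zero]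
  simp only [hterm]
  rw [Finset.sum_sub_distrib, Finset.sum_add_distrib, Finset.sum_ite_eq, Finset.sum_ite_eq,
    Finset.sum_ite_eq, if_pos (H.omega_mem_bohr α ha), if_pos (H.omega_mem_bohr α hb),
    if_pos (H.omega_mem_bohr α hb), ← add_smul]
  congr 2
  push_cast
  ring

theorem davies_one (h : PauliLabel N → ℝ → ℝ) : H.davies h 1 = 0 := by
  change (∑ α ∈ W1 N, ∑ ω ∈ H.bohr, _ : Op N) = 0
  refine Finset.sum_eq_zero fun α _ => Finset.sum_eq_zero fun ω _ => ?_
  rw [mul_one, one_mul, mul_one, ← two_smul ℂ, smul_smul]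
  norm_num

theorem dirichlet_eq (β : ℝ) (h : PauliLabel N → ℝ → ℝ) (f : Op N) :
    dirichlet (H.gibbs β) (H.davies h) f = ∑ α ∈ W1 N, ∑ b, ∑ a, H.gibbsWeight β b *
      ((h α (H.omega α a) + h α (H.omega α b)) / 2 * frobSq (H.proj a * f * H.proj b) -
        (if H.omega α a = H.omega α b then h α (H.omega α b) else 0) *
          ((H.proj a * f * H.proj b)ᴴ * (H.proj a * conj α f * H.proj b)).trace.re) := by
  have h1 : dirichlet (H.gibbs β) (H.davies h) f = ∑ b, ∑ a, ∑ α ∈ W1 N, H.gibbsWeight β b *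
      ((h α (H.omega α a) + h α (H.omega α b)) / 2 * frobSq (H.proj a * f * H.proj b) -
        (if H.omega α a = H.omega α b then h α (H.omega α b) else 0) *
          ((H.proj a * f * H.proj b)ᴴ * (H.proj a * conj α f * H.proj b)).trace.re) := by
    rw [dirichlet, trace_gibbs_mul, Complex.re_sum, ← Finset.sum_neg_distrib]
    refine Finset.sum_congr rfl fun b _ => ?_
    rw [H.trace_eq_sum_blocks, Complex.re_ofReal_mul, Complex.re_sum, Finset.mul_sum,
      ← Finset.sum_neg_distrib]
    refine Finset.sum_congr rfl fun a _ => ?_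
    rw [← mul_assoc (H.proj a) f, ← mul_assoc (H.proj a) (H.davies h f),
      proj_mul_davies_mul_proj, Finset.mul_sum, Matrix.trace_sum,
      Complex.re_sum, Finset.mul_sum, ← Finset.sum_neg_distrib]
    refine Finset.sum_congr rfl fun α _ => ?_
    rw [mul_sub, Matrix.trace_sub, Matrix.mul_smul, Matrix.trace_smul, Matrix.mul_smul,
      Matrix.trace_smul, smul_eq_mul, smul_eq_mul, Complex.sub_re, Complex.re_ofReal_mul,
      Complex.re_ofReal_mul, frobSq]
    ring
  rw [h1, Finset.sum_comm (s := W1 N)]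
  exact Finset.sum_congr rfl fun b _ => Finset.sum_comm

/-- Detailed balance. -/
theorem gibbsWeight_mul_rate {β : ℝ} {h : ℝ → ℝ}
    (hKMS : ∀ ω, h (-ω) = h ω * Real.exp (-β * ω)) (α : PauliLabel N) (b : Fin M → ZMod 2) :
    H.gibbsWeight β (b + H.syndrome α) * h (H.omega α (b + H.syndrome α)) =
      H.gibbsWeight β b * h (H.omega α b) := by
  have hexp : Real.exp (-β * H.energy (b + H.syndrome α)) * Real.exp (-β * H.omega α b) =
      Real.exp (-β * H.energy b) := by
    rw [← Real.exp_add, omega]; congr 1; ring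
  rw [omega_add_syndrome, hKMS, gibbsWeight, gibbsWeight, ← hexp]
  ring

theorem proj_mul_conj_mul_proj (α : PauliLabel N) (f : Op N) (a b : Fin M → ZMod 2) :
    H.proj a * conj α f * H.proj b =
      conj α (H.proj (a + H.syndrome α) * f * H.proj (b + H.syndrome α)) := by
  rw [conj_mul, conj_mul, conj_proj, conj_proj, add_add_self, add_add_self]

/-- The contribution of one coupling to the Dirichlet form. Blocks whose two syndromes have equal
Bohr frequencies contribute half of the squared difference by detailed balance; the other blocks
are only damped, and `‖x - y‖² ≤ 2‖x‖² + 2‖y‖²` reduces the constant to `1 / 8`. -/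
theorem coupling_dirichlet_ge {β : ℝ} {h : ℝ → ℝ} (hpos : ∀ ω, 0 < h ω)
    (hKMS : ∀ ω, h (-ω) = h ω * Real.exp (-β * ω)) (α : PauliLabel N) (f : Op N) :
    (1 / 8) * ∑ b, H.gibbsWeight β b * h (H.omega α b) * frobSq ((f - conj α f) * H.proj b) ≤
      ∑ b, ∑ a, H.gibbsWeight β b *
        ((h (H.omega α a) + h (H.omega α b)) / 2 * frobSq (H.proj a * f * H.proj b) -
          (if H.omega α a = H.omega α b then h (H.omega α b) else 0) *
            ((H.proj a * f * H.proj b)ᴴ * (H.proj a * conj α f * H.proj b)).trace.re) := by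
  set e := H.syndrome α with he
  let u : (Fin M → ZMod 2) → ℝ := fun b => H.gibbsWeight β b * h (H.omega α b)
  let F : (Fin M → ZMod 2) → (Fin M → ZMod 2) → Op N := fun a b => H.proj a * f * H.proj b
  let G : (Fin M → ZMod 2) → (Fin M → ZMod 2) → Op N := fun a b => H.proj a * conj α f * H.proj b
  let T : (Fin M → ZMod 2) → (Fin M → ZMod 2) → ℝ := fun a b =>
    if H.omega α a = H.omega α b then u b * (frobSq (F a b) - ((F a b)ᴴ * G a b).trace.re)
    else u b * frobSq (F a b) / 2
  have hu0 : ∀ b, 0 ≤ u b := fun b => (mul_pos (H.gibbsWeight_pos β b) (hpos _)).le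
  have hu : ∀ b, u (b + e) = u b := fun b => H.gibbsWeight_mul_rate hKMS α b
  have hG : ∀ a b, G a b = conj α (F (a + e) (b + e)) := fun a b =>
    H.proj_mul_conj_mul_proj α f a b
  have hF : ∀ a b, F (a + e) (b + e) = conj α (G a b) := fun a b => by rw [hG, conj_conj]
  -- conjugation by `σ(α)` exchanges the blocks of `f` and of `σ(α) f σ(α)`
  have hG' : ∀ a b, G (a + e) (b + e) = conj α (F a b) := fun a b => by
    rw [hG, add_add_self, add_add_self]
  have hR : ∀ a b, ((F (a + e) (b + e))ᴴ * G (a + e) (b + e)).trace.re =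
      ((F a b)ᴴ * G a b).trace.re := fun a b => by
    rw [hF, hG', conj_conjTranspose, ← conj_mul, trace_conj, re_trace_conjTranspose_mul_comm]
  have hT : ∀ a b, T a b ≤ H.gibbsWeight β b *
      ((h (H.omega α a) + h (H.omega α b)) / 2 * frobSq (H.proj a * f * H.proj b) -
        (if H.omega α a = H.omega α b then h (H.omega α b) else 0) *
          ((H.proj a * f * H.proj b)ᴴ * (H.proj a * conj α f * H.proj b)).trace.re) := by
    intro a b
    simp only [T]
    split_ifs with hab
    · rw [hab]
      simp only [u, F, G]
      exact le_of_eq (by ring)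
    · -- the damping at the rate of the left syndrome `a` is discarded
      have h0 : 0 ≤ H.gibbsWeight β b * h (H.omega α a) * frobSq (F a b) :=
        mul_nonneg (mul_pos (H.gibbsWeight_pos β b) (hpos _)).le (frobSq_nonneg _)
      simp only [u, F] at h0 ⊢
      linarith
  -- a block and its image under the coupling are treated together
  have hpair : ∀ a b, (1 / 4) * (u b * frobSq (F a b - G a b)) ≤ T a b + T (a + e) (b + e) := by
    intro a b
    have hiff : H.omega α (a + e) = H.omega α (b + e) ↔ H.omega α a = H.omega α b := by
      rw [he, omega_add_syndrome, omega_add_syndrome, neg_inj]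
    have h1 : frobSq (F (a + e) (b + e)) = frobSq (G a b) := by rw [hF, frobSq_conj]
    simp only [T, hiff, hu, hR, h1]
    split_ifs with hab
    · have := frobSq_sub (F a b) (G a b)
      have h2 : 0 ≤ u b * frobSq (F a b - G a b) := mul_nonneg (hu0 b) (frobSq_nonneg _)
      rw [this] at h2 ⊢
      linarith
    · have := mul_le_mul_of_nonneg_left (frobSq_sub_le (F a b) (G a b)) (hu0 b)
      linarith
  have hshift : ∑ b, ∑ a, T (a + e) (b + e) = ∑ b, ∑ a, T a b := by
    rw [sum_add_syndrome e fun b => ∑ a, T (a + e) b]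
    exact Finset.sum_congr rfl fun b _ => sum_add_syndrome e fun a => T a b
  have hblocks : ∑ b, u b * frobSq ((f - conj α f) * H.proj b) =
      ∑ b, ∑ a, u b * frobSq (F a b - G a b) := by
    refine Finset.sum_congr rfl fun b _ => ?_
    rw [H.frobSq_eq_sum_blocks, Finset.mul_sum]
    refine Finset.sum_congr rfl fun a _ => ?_
    simp only [F, G, sub_mul, mul_sub, mul_assoc]
  have hmain : (1 / 4) * ∑ b, u b * frobSq ((f - conj α f) * H.proj b) ≤
      2 * ∑ b, ∑ a, T a b := by
    calc (1 / 4) * ∑ b, u b * frobSq ((f - conj α f) * H.proj b)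
        = ∑ b, ∑ a, (1 / 4) * (u b * frobSq (F a b - G a b)) := by
          simp only [hblocks, Finset.mul_sum]
      _ ≤ ∑ b, ∑ a, (T a b + T (a + e) (b + e)) :=
          Finset.sum_le_sum fun b _ => Finset.sum_le_sum fun a _ => hpair a b
      _ = 2 * ∑ b, ∑ a, T a b := by
          simp only [Finset.sum_add_distrib]
          rw [hshift, two_mul]
  have hle : ∑ b, ∑ a, T a b ≤ _ :=
    Finset.sum_le_sum fun b _ => Finset.sum_le_sum fun a _ => hT a b
  refine le_trans ?_ hle
  have : ∑ b, H.gibbsWeight β b * h (H.omega α b) * frobSq ((f - conj α f) * H.proj b) =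
    ∑ b, u b * frobSq ((f - conj α f) * H.proj b) := rfl
  rw [this]
  linarith

theorem dirichlet_ge {β : ℝ} {h : PauliLabel N → ℝ → ℝ} (hpos : ∀ α ∈ W1 N, ∀ ω, 0 < h α ω)
    (hKMS : ∀ α ∈ W1 N, ∀ ω, h α (-ω) = h α ω * Real.exp (-β * ω)) (f : Op N) :
    (1 / 8) * ∑ α ∈ W1 N, ∑ b, H.gibbsWeight β b * h α (H.omega α b) *
      frobSq ((f - conj α f) * H.proj b) ≤ dirichlet (H.gibbs β) (H.davies h) f := by
  rw [dirichlet_eq, Finset.mul_sum]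
  exact Finset.sum_le_sum fun α hα => H.coupling_dirichlet_ge (hpos α hα) (hKMS α hα) α f

theorem minRate_le {h : PauliLabel N → ℝ → ℝ} (hpos : ∀ α ∈ W1 N, ∀ ω, 0 < h α ω)
    {α : PauliLabel N} (hα : α ∈ W1 N) {b : Fin M → ZMod 2} (hb : H.proj b ≠ 0) :
    H.minRate h ≤ h α (H.omega α b) := by
  refine csInf_le ⟨0, ?_⟩ ⟨α, hα, b, by simpa [syndromes] using hb, rfl⟩
  rintro _ ⟨α, hα, a, _, rfl⟩
  exact (hpos α hα _).le

theorem minRate_nonneg {h : PauliLabel N → ℝ → ℝ} (hpos : ∀ α ∈ W1 N, ∀ ω, 0 < h α ω) :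
    0 ≤ H.minRate h := by
  refine Real.sInf_nonneg ?_
  rintro _ ⟨α, hα, a, _, rfl⟩
  exact (hpos α hα _).le

theorem dirichlet_nonneg {β : ℝ} {h : PauliLabel N → ℝ → ℝ}
    (hpos : ∀ α ∈ W1 N, ∀ ω, 0 < h α ω)
    (hKMS : ∀ α ∈ W1 N, ∀ ω, h α (-ω) = h α ω * Real.exp (-β * ω)) (f : Op N) :
    0 ≤ dirichlet (H.gibbs β) (H.davies h) f := by
  refine le_trans ?_ (H.dirichlet_ge hpos hKMS f)
  refine mul_nonneg (by norm_num) (Finset.sum_nonneg fun α hα => Finset.sum_nonneg fun b _ => ?_)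
  exact mul_nonneg (mul_pos (H.gibbsWeight_pos β b) (hpos α hα _)).le (frobSq_nonneg _)

/-- The Poincaré inequality, with the constant cleared of denominators. -/
theorem minRate_mul_variance_le {β : ℝ} (hβ : 0 ≤ β) {h : PauliLabel N → ℝ → ℝ}
    (hpos : ∀ α ∈ W1 N, ∀ ω, 0 < h α ω)
    (hKMS : ∀ α ∈ W1 N, ∀ ω, h α (-ω) = h α ω * Real.exp (-β * ω))
    {C : ℝ} (Γ : ∀ η : PauliLabel N, PauliPath η) (hΓ : ∀ η, (Γ η).cost H ≤ C) (f : Op N) :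
    H.minRate h * variance (H.gibbs β) f ≤ 4 * maxLength Γ * Real.exp (2 * β * C) *
      dirichlet (H.gibbs β) (H.davies h) f := by
  have h1 := mul_le_mul_of_nonneg_left (H.variance_le hβ Γ hΓ f) (H.minRate_nonneg hpos)
  have h2 : H.minRate h * ∑ α ∈ W1 N, ∑ b, H.gibbsWeight β b *
      frobSq ((f - conj α f) * H.proj b) ≤ 8 * dirichlet (H.gibbs β) (H.davies h) f := by
    have h3 : H.minRate h * ∑ α ∈ W1 N, ∑ b, H.gibbsWeight β b *
        frobSq ((f - conj α f) * H.proj b) ≤ ∑ α ∈ W1 N, ∑ b, H.gibbsWeight β b *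
          h α (H.omega α b) * frobSq ((f - conj α f) * H.proj b) := by
      simp only [Finset.mul_sum]
      refine Finset.sum_le_sum fun α hα => Finset.sum_le_sum fun b _ => ?_
      by_cases hb : H.proj b = 0
      · simp [hb, frobSq_zero]
      · have := mul_le_mul_of_nonneg_left (H.minRate_le hpos hα hb)
          (mul_nonneg (H.gibbsWeight_pos β b).le (frobSq_nonneg ((f - conj α f) * H.proj b)))
        linarith
    linarith [H.dirichlet_ge hpos hKMS f]
  have h4 := mul_le_mul_of_nonneg_left h2
    (mul_nonneg (Nat.cast_nonneg (α := ℝ) (maxLength Γ)) (Real.exp_pos (2 * β * C)).le)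
  linarith

end CommutingPauli

/-! ### From the Poincaré inequality to the spectral gap -/

/-- Positivity of the Dirichlet form on `g + s • 1` for all scalars `s` forces `ρ` to be
stationary. -/
theorem trace_mul_apply_eq_zero {ρ : Op N} {L : Op N →ₗ[ℂ] Op N} (hL1 : L 1 = 0)
    (hE : ∀ f, 0 ≤ dirichlet ρ L f) (g : Op N) : (ρ * L g).trace = 0 := by
  by_contra hz
  set z := (ρ * L g).trace with hzdef
  have hz2 : 0 < ‖z‖ ^ 2 := by positivity
  have key : ∀ r : ℝ, dirichlet ρ L (g + ((r : ℂ) * z) • 1) = dirichlet ρ L g - r * ‖z‖ ^ 2 := by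
    intro r
    have h1 : (ρ * (g + ((r : ℂ) * z) • 1)ᴴ * L (g + ((r : ℂ) * z) • 1)).trace =
        (ρ * gᴴ * L g).trace + ((r * ‖z‖ ^ 2 : ℝ) : ℂ) := by
      rw [map_add, map_smul, hL1, smul_zero, add_zero, Matrix.conjTranspose_add,
        Matrix.conjTranspose_smul, Matrix.conjTranspose_one, mul_add, add_mul, Matrix.trace_add,
        Matrix.mul_smul, mul_one, Matrix.smul_mul, Matrix.trace_smul, ← hzdef, smul_eq_mul,
        star_mul', Complex.star_def, Complex.conj_ofReal,
        mul_assoc (r : ℂ), Complex.conj_mul']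
      push_cast
      ring
    rw [dirichlet, h1, Complex.add_re, Complex.ofReal_re, dirichlet]
    ring
  have h := hE (g + ((((dirichlet ρ L g + 1) / ‖z‖ ^ 2 : ℝ) : ℂ) * z) • 1)
  rw [key, div_mul_cancel₀ _ hz2.ne'] at h
  linarith

/-- A Poincaré inequality with respect to a faithful state bounds the spectral gap from below.
Eigenvectors for nonzero eigenvalues have vanishing expectation; conversely such an eigenvalue
exists on the space of operators with vanishing expectation, so the infimum is not over the empty
set. -/
theorem le_spectralGap (hN : 0 < N) {ρ : Op N} (hρ : ρᴴ = ρ)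
    (hpos : ∀ f : Op N, f ≠ 0 → 0 < (ρ * fᴴ * f).trace.re) {L : Op N →ₗ[ℂ] Op N} (hL1 : L 1 = 0)
    (hE : ∀ f, 0 ≤ dirichlet ρ L f) {c : ℝ}
    (hc : ∀ f, c * variance ρ f ≤ dirichlet ρ L f) : c ≤ spectralGap L := by
  have hvar : ∀ f : Op N, (ρ * f).trace = 0 → variance ρ f = (ρ * fᴴ * f).trace.re := by
    intro f hf
    rw [variance, hf, norm_zero]; ring
  have hstat := trace_mul_apply_eq_zero hL1 hE
  have hbound : ∀ x ∈ {x | ∃ μ : ℂ, Module.End.HasEigenvalue L μ ∧ μ ≠ 0 ∧ x = -μ.re},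
      c ≤ x := by
    rintro _ ⟨μ, hμ, hμ0, rfl⟩
    obtain ⟨f, hf⟩ := hμ.exists_hasEigenvector
    have hLf : L f = μ • f := hf.apply_eq_smul
    have hf0 : (ρ * f).trace = 0 := by
      have := hstat f
      rw [hLf, Matrix.mul_smul, Matrix.trace_smul, smul_eq_mul] at this
      exact (mul_eq_zero.1 this).resolve_left hμ0
    have him : (ρ * fᴴ * f).trace.im = 0 := by
      refine Complex.conj_eq_iff_im.1 ?_
      rw [← Complex.star_def, ← Matrix.trace_conjTranspose, Matrix.conjTranspose_mul,
        Matrix.conjTranspose_mul, Matrix.conjTranspose_conjTranspose, hρ, ← mul_assoc,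
        Matrix.trace_mul_comm, ← mul_assoc]
    have h := hc f
    rw [hvar f hf0, dirichlet, hLf, Matrix.mul_smul, Matrix.trace_smul, smul_eq_mul,
      Complex.mul_re, him, mul_zero, sub_zero, ← neg_mul] at h
    exact le_of_mul_le_mul_right h (hpos f hf.2)
  -- for `c ≤ 0` the convention `sInf ∅ = 0` settles the case of no nonzero eigenvalue
  rcases le_or_gt c 0 with hc0 | hc0
  · rcases Set.eq_empty_or_nonempty
      {x | ∃ μ : ℂ, Module.End.HasEigenvalue L μ ∧ μ ≠ 0 ∧ x = -μ.re} with he | hne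
    · rw [spectralGap, he, Real.sInf_empty]; exact hc0
    · exact le_csInf hne hbound
  refine le_csInf ?_ hbound
  let φ : Op N →ₗ[ℂ] ℂ := (Matrix.traceLinearMap (Qubits N) ℂ ℂ).comp (LinearMap.mulLeft ℂ ρ)
  have hφ : ∀ f, φ f = (ρ * f).trace := fun f => rfl
  have hmap : ∀ f ∈ φ.ker, L f ∈ φ.ker := fun f _ => by
    rw [LinearMap.mem_ker, hφ, hstat]
  have hnt : Nontrivial φ.ker := by
    rw [Submodule.nontrivial_iff_ne_bot]
    refine LinearMap.ker_ne_bot_of_finrank_lt ?_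
    rw [Module.finrank_self, Module.finrank_matrix, Module.finrank_self, mul_one]
    have h2 : 2 ≤ Fintype.card (Qubits N) := by
      rw [Fintype.card_fun, Fintype.card_fin, Fintype.card_fin]
      exact Nat.le_self_pow hN.ne' 2
    nlinarith
  obtain ⟨μ, hμ⟩ := Module.End.exists_eigenvalue (L.restrict hmap)
  obtain ⟨f, hf⟩ := hμ.exists_hasEigenvector
  have hf0 : (f : Op N) ≠ 0 := fun h => hf.2 (Subtype.ext h)
  have hLf : L f = μ • (f : Op N) := congrArg Subtype.val hf.apply_eq_smul
  have hker : (ρ * (f : Op N)).trace = 0 := f.2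
  refine ⟨-μ.re, μ, Module.End.hasEigenvalue_of_hasEigenvector
    ⟨Module.End.mem_eigenspace_iff.2 hLf, hf0⟩, ?_, rfl⟩
  rintro rfl
  have h := hc f
  rw [hvar f hker, dirichlet, hLf, zero_smul, mul_zero, Matrix.trace_zero, Complex.zero_re,
    neg_zero] at h
  exact absurd h (not_le.2 (mul_pos hc0 (hpos f hf0)))

theorem CommutingPauli.re_trace_gibbs_mul_pos (H : CommutingPauli N M) (β : ℝ) {f : Op N}
    (hf : f ≠ 0) : 0 < (H.gibbs β * fᴴ * f).trace.re := by
  rw [H.trace_gibbs_mul, Complex.re_sum]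
  simp only [Complex.re_ofReal_mul]
  have hex : ∃ b, f * H.proj b ≠ 0 := by
    by_contra! h
    apply hf
    rw [← mul_one f, ← H.sum_proj, Finset.mul_sum]
    exact Finset.sum_eq_zero fun b _ => h b
  obtain ⟨b, hb⟩ := hex
  exact Finset.sum_pos'
    (fun b _ => mul_nonneg (H.gibbsWeight_pos β b).le (frobSq_nonneg (f * H.proj b)))
    ⟨b, Finset.mem_univ b, mul_pos (H.gibbsWeight_pos β b) (frobSq_pos hb)⟩

/-! ### Existence and length of Pauli paths -/

/-- The label acting as `p` on the qubit `i` and trivially elsewhere. -/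
def singleQubit (i : Fin N) (p : ZMod 2 × ZMod 2) : PauliLabel N :=
  (Pi.single i p.1, Pi.single i p.2)

theorem weight_singleQubit (i : Fin N) {p : ZMod 2 × ZMod 2} (hp : p ≠ 0) :
    weight (singleQubit i p) = 1 := by
  rw [weight, Finset.card_eq_one]
  refine ⟨i, Finset.ext fun j => ?_⟩
  rw [Finset.mem_filter, Finset.mem_singleton]
  rcases eq_or_ne j i with rfl | hj
  · simpa [singleQubit, Prod.ext_iff, or_iff_not_imp_left] using hp
  · simp [singleQubit, hj]

theorem exists_eq_singleQubit {α : PauliLabel N} (hα : α ∈ W1 N) :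
    ∃ i, ∃ p ≠ 0, singleQubit i p = α := by
  obtain ⟨i, hi⟩ := Finset.card_eq_one.1 (Finset.mem_filter.1 hα).2
  have hmem : ∀ j, (α.1 j ≠ 0 ∨ α.2 j ≠ 0) ↔ j = i := fun j => by
    rw [← Finset.mem_singleton, ← hi]; simp
  refine ⟨i, (α.1 i, α.2 i), fun h => ?_, ?_⟩
  · have h' := (hmem i).2 rfl
    simp only [Prod.mk_eq_zero] at h
    exact h'.elim (fun h1 => h1 h.1) fun h1 => h1 h.2
  · refine Prod.ext (funext fun j => ?_) (funext fun j => ?_) <;>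
    · rcases eq_or_ne j i with rfl | hj
      · simp [singleQubit]
      · have := (hmem j).not.2 hj
        push Not at this
        simp [singleQubit, hj, this]

theorem card_W1_le (N : ℕ) : (W1 N).card ≤ 3 * N := by
  have hsub : W1 N ⊆ (Finset.univ ×ˢ (Finset.univ.filter fun p : ZMod 2 × ZMod 2 => p ≠ 0)).image
      fun q => singleQubit q.1 q.2 := by
    intro α hα
    obtain ⟨i, p, hp, h⟩ := exists_eq_singleQubit hα
    exact Finset.mem_image.2 ⟨(i, p), by simp [hp], h⟩
  have h3 : (Finset.univ.filter fun p : ZMod 2 × ZMod 2 => p ≠ 0).card = 3 := by decide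
  refine (Finset.card_le_card hsub).trans (Finset.card_image_le.trans ?_)
  rw [Finset.card_product, h3, Finset.card_univ, Fintype.card_fin, mul_comm]

theorem PauliPath.length_le {η : PauliLabel N} (p : PauliPath η) : p.length ≤ 3 * N := by
  rw [PauliPath.length, ← List.toFinset_card_of_nodup p.nodup]
  exact (Finset.card_le_card fun α hα => p.mem_W1 α (List.mem_toFinset.1 hα)).trans (card_W1_le N)

/-- Every label is the sum of its restrictions to the qubits of its support. -/
instance (η : PauliLabel N) : Nonempty (PauliPath η) := by
  let s : Finset (Fin N) := Finset.univ.filter fun i => (η.1 i, η.2 i) ≠ 0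
  let g : Fin N → PauliLabel N := fun i => singleQubit i (η.1 i, η.2 i)
  refine ⟨⟨s.toList.map g, ?_, ?_, ?_⟩⟩
  · intro α hα
    obtain ⟨i, hi, rfl⟩ := List.mem_map.1 hα
    have hi' : (η.1 i, η.2 i) ≠ 0 := by simpa [s] using hi
    exact Finset.mem_filter.2 ⟨Finset.mem_univ _, weight_singleQubit i hi'⟩
  · refine s.nodup_toList.map_on ?_
    intro i hi j hj hij
    have hi' : (η.1 i, η.2 i) ≠ 0 := by simpa [s] using hi
    by_contra hne
    have h1 := congrFun (congrArg Prod.fst hij) i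
    have h2 := congrFun (congrArg Prod.snd hij) i
    simp only [g, singleQubit, Pi.single_eq_same, Pi.single_eq_of_ne hne] at h1 h2
    exact hi' (Prod.ext h1 h2)
  · rw [Finset.sum_map_toList]
    have h0 : ∑ i ∈ s, g i = ∑ i, g i := by
      refine Finset.sum_subset (Finset.subset_univ s) fun i _ hi => ?_
      have hi' : (η.1 i, η.2 i) = 0 := by simpa [s] using hi
      obtain ⟨h1, h2⟩ := Prod.mk_eq_zero.1 hi'
      simp only [g, singleQubit, h1, h2, Pi.single_zero, Prod.mk_zero_zero]
    rw [h0]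
    refine Prod.ext ?_ ?_
    · rw [Prod.fst_sum]; exact Finset.univ_sum_single η.1
    · rw [Prod.snd_sum]; exact Finset.univ_sum_single η.2

instance (η : PauliLabel N) : Finite (PauliPath η) :=
  Finite.of_injective
    (fun p : PauliPath η => (⟨p.steps, p.nodup⟩ : {l : List (PauliLabel N) // l.Nodup}))
    fun p q h => by
      cases p; cases q
      simpa using h

theorem maxLength_le (Γ : ∀ η : PauliLabel N, PauliPath η) : maxLength Γ ≤ 3 * N :=
  Finset.sup_le fun η _ => (Γ η).length_le

theorem maxLength_pos (hN : 0 < N) (Γ : ∀ η : PauliLabel N, PauliPath η) : 0 < maxLength Γ := by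
  let η : PauliLabel N := singleQubit ⟨0, hN⟩ (1, 0)
  have hη : η ≠ 0 := fun h => by
    have := congrFun (congrArg Prod.fst h) ⟨0, hN⟩
    simp [η, singleQubit] at this
  refine lt_of_lt_of_le (List.length_pos_of_ne_nil fun h => hη ?_)
    (Finset.le_sup (f := fun η => (Γ η).length) (Finset.mem_univ η))
  rw [← (Γ η).sum_steps, h, List.sum_nil]

end PauliDavies
end

theorem theorem4 {N M : ℕ} (hN : 0 < N) (H : PauliDavies.CommutingPauli N M)
    (β : ℝ) (hβ : 0 ≤ β) (h : PauliDavies.PauliLabel N → ℝ → ℝ)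
    (hpos : ∀ α ∈ PauliDavies.W1 N, ∀ ω, 0 < h α ω)
    (hKMS : ∀ α ∈ PauliDavies.W1 N, ∀ ω, h α (-ω) = h α ω * Real.exp (-β * ω)) :
    (∃ Γ : ∀ η : PauliDavies.PauliLabel N, PauliDavies.PauliPath η,
      ∀ η, (Γ η).cost H = PauliDavies.energyCost H η) ∧
    (∀ Γ : ∀ η : PauliDavies.PauliLabel N, PauliDavies.PauliPath η,
      (∀ η, (Γ η).cost H ≤ PauliDavies.genBarrier H) →
      PauliDavies.maxLength Γ ≤ 3 * N ∧
      H.minRate h / (4 * PauliDavies.maxLength Γ) *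
          Real.exp (-2 * β * PauliDavies.genBarrier H) ≤
        PauliDavies.spectralGap (H.davies h) ∧
      ∀ f : PauliDavies.Op N,
        H.minRate h / (4 * PauliDavies.maxLength Γ) *
            Real.exp (-2 * β * PauliDavies.genBarrier H) *
            PauliDavies.variance (H.gibbs β) f ≤
          PauliDavies.dirichlet (H.gibbs β) (H.davies h) f) ∧
    H.minRate h / (12 * N) * Real.exp (-2 * β * PauliDavies.genBarrier H) ≤
      PauliDavies.spectralGap (H.davies h) := by
  have hmin : ∃ Γ : ∀ η : PauliDavies.PauliLabel N, PauliDavies.PauliPath η,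
      ∀ η, (Γ η).cost H = PauliDavies.energyCost H η := by
    choose Γ hΓ using fun η : PauliDavies.PauliLabel N =>
      exists_eq_ciInf_of_finite (f := fun p : PauliDavies.PauliPath η => p.cost H)
    exact ⟨Γ, hΓ⟩
  have hmain : ∀ Γ : ∀ η : PauliDavies.PauliLabel N, PauliDavies.PauliPath η,
      (∀ η, (Γ η).cost H ≤ PauliDavies.genBarrier H) →
      H.minRate h / (4 * PauliDavies.maxLength Γ) *
          Real.exp (-2 * β * PauliDavies.genBarrier H) ≤
        PauliDavies.spectralGap (H.davies h) ∧
      ∀ f : PauliDavies.Op N,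
        H.minRate h / (4 * PauliDavies.maxLength Γ) *
            Real.exp (-2 * β * PauliDavies.genBarrier H) *
            PauliDavies.variance (H.gibbs β) f ≤
          PauliDavies.dirichlet (H.gibbs β) (H.davies h) f := by
    intro Γ hΓ
    have hlen : (0 : ℝ) < PauliDavies.maxLength Γ := by
      exact_mod_cast PauliDavies.maxLength_pos hN Γ
    have hpoincare : ∀ f : PauliDavies.Op N,
        H.minRate h / (4 * PauliDavies.maxLength Γ) *
            Real.exp (-2 * β * PauliDavies.genBarrier H) *
            PauliDavies.variance (H.gibbs β) f ≤
          PauliDavies.dirichlet (H.gibbs β) (H.davies h) f := by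
      intro f
      have hexp : Real.exp (-2 * β * PauliDavies.genBarrier H) =
          (Real.exp (2 * β * PauliDavies.genBarrier H))⁻¹ := by
        rw [← Real.exp_neg]; congr 1; ring
      have hle := H.minRate_mul_variance_le hβ hpos hKMS Γ hΓ f
      rw [hexp, div_mul_eq_mul_div, div_mul_eq_mul_div, div_le_iff₀ (by positivity),
        mul_right_comm, ← div_eq_mul_inv, div_le_iff₀ (Real.exp_pos _)]
      linarith
    exact ⟨PauliDavies.le_spectralGap hN (H.gibbs_conjTranspose β)
      (fun f hf => H.re_trace_gibbs_mul_pos β hf) (H.davies_one h)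
      (H.dirichlet_nonneg hpos hKMS) hpoincare, hpoincare⟩
  refine ⟨hmin, fun Γ hΓ => ⟨PauliDavies.maxLength_le Γ, hmain Γ hΓ⟩, ?_⟩
  obtain ⟨Γ, hΓ⟩ := hmin
  have hlen : (0 : ℝ) < PauliDavies.maxLength Γ := by
    exact_mod_cast PauliDavies.maxLength_pos hN Γ
  have hlen' : (PauliDavies.maxLength Γ : ℝ) ≤ 3 * N := by
    exact_mod_cast PauliDavies.maxLength_le Γ
  refine le_trans ?_ (hmain Γ fun η => ?_).1
  · refine mul_le_mul_of_nonneg_right ?_ (Real.exp_pos _).le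
    exact div_le_div_of_nonneg_left (H.minRate_nonneg hpos) (by positivity) (by linarith)
  · rw [hΓ]
    exact Finset.le_sup' (PauliDavies.energyCost H) (Finset.mem_univ η)
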